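/- Let $\mathbb{D}=\{z\in\mathbb{C}:|z|<1\}$. Let $\mathcal{C}_3$ be the class of analytic functions $f$ on $\mathbb{D}$ for which there is a convex function $g$ (analytic and univalent on $\mathbb{D}$, with $g(\mathbb{D})$ convex) of the form $g(z)=b_1z+\cdots$, $\operatorname{Re} b_1>0$, such that $$\operatorname{Re}\left(\frac{\big(z(zf')'\big)'}{(zg')'}\right)>0\qquad(z\in\mathbb{D}).$$ Let $N\ge 1$ be an integer. **Theorem.** The equation $$\sum_{n=N}^{\infty}\frac{r^n}{3n^2}-\frac13\int_0^r\frac{\log(1-t)}{t}\,dt-\frac{12+\pi^2-36r-\pi^2r-24r^N}{36(1-r)}=0$$ has exactly one root $r=R_{1,N}$ in $(0,1)$. For every $f(z)=z+\sum_{n=2}^{\infty}a_nz^n$ in $\mathcal{C}_3$ (with $a_0=0$, $a_1=1$), $$|f(z)|+\sum_{n=N}^{\infty}|a_nz^n|\le d\big(f(0),\partial f(\mathbb{D})\big)\qquad\text{for } |z|\le R_{1,N},$$ where $d$ is the Euclidean distance and $\partial f(\mathbb{D})$ is the boundary of $f(\mathbb{D})$. The radius $R_{1,N}$ is sharp: there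 is a function $f(z)=z+\sum_{n\ge2}a_nz^n$ in $\mathcal{C}_3$ for which equality holds at $z=R_{1,N}$ and for which the inequality fails at $z=r$ for every $r\in(R_{1,N},1)$. -/

import Mathlib

open Set Metric

/-- The operator `f ↦ z f'`. -/
noncomputable def eulerOp (f : ℂ → ℂ) : ℂ → ℂ := fun z => z * deriv f z

/-- The `n`-th Taylor coefficient of `f` at the origin. -/
noncomputable def taylorCoeff (f : ℂ → ℂ) (n : ℕ) : ℂ :=
  iteratedDeriv n f 0 / (n.factorial : ℂ)

/-- `g` is a convex function of the form `g(z) = b₁ z + ⋯` with `Re b₁ > 0`: it is analytic and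
univalent in the open unit disc, and it maps the disc onto a convex domain. -/
structure IsConvexMap (g : ℂ → ℂ) : Prop where
  analytic : DifferentiableOn ℂ g (ball 0 1)
  univalent : InjOn g (ball 0 1)
  convex_image : Convex ℝ (g '' ball 0 1)
  map_zero : g 0 = 0
  re_deriv_pos : 0 < (deriv g 0).re

/-- The class `𝒞₃`: analytic functions `f` in the unit disc for which there is a convex function
`g` with `Re ((z (z f')')' / (z g')') > 0` in the unit disc. (Where the denominator vanishes the
quotient is `0` here, so the condition forces the denominator to have no zeros in the disc.) -/
structure ClassC3 (f : ℂ → ℂ) : Prop where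
  analytic : DifferentiableOn ℂ f (ball 0 1)
  exists_convex : ∃ g : ℂ → ℂ, IsConvexMap g ∧
    ∀ z ∈ ball (0 : ℂ) 1, 0 < (deriv (eulerOp (eulerOp f)) z / deriv (eulerOp g) z).re

/-- `f ∈ 𝒞₃` with the normalization `f(z) = z + a₂ z² + ⋯`. -/
structure NormalizedC3 (f : ℂ → ℂ) : Prop where
  mem : ClassC3 f
  map_zero : f 0 = 0
  deriv_zero : deriv f 0 = 1

/-- The Bohr–Rogosinski sum `|f(z)| + ∑_{n ≥ N} |a_n z^n|`. -/
noncomputable def bohrRogosinskiSum (N : ℕ) (f : ℂ → ℂ) (z : ℂ) : ℝ :=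
  ‖f z‖ + ∑' n : ℕ, ‖taylorCoeff f (N + n) * z ^ (N + n)‖

/-- The Euclidean distance from `f(0)` to the boundary of the image of the unit disc. -/
noncomputable def boundaryDist (f : ℂ → ℂ) : ℝ :=
  infDist (f 0) (frontier (f '' ball 0 1))

/-- The left-hand side of the equation that determines the radius. -/
noncomputable def radiusFun (N : ℕ) (r : ℝ) : ℝ :=
  (∑' n : ℕ, r ^ (N + n) / (3 * ((N + n : ℕ) : ℝ) ^ 2))
    - 1 / 3 * (∫ t in (0 : ℝ)..r, Real.log (1 - t) / t)
    - (12 + Real.pi ^ 2 - 36 * r - Real.pi ^ 2 * r - 24 * r ^ N) / (36 * (1 - r))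

/-! Two sharp facts about the class carry the theorem: |a_n| ≤ 2/3 + 1/(3n²) for n ≥ 1, and the
image of the disc contains the disc of radius (12 + π²)/36. The first bounds the Bohr–Rogosinski sum
by two tails of ∑ (2/3 + 1/(3n²)) rⁿ, which together increase strictly with r; the second bounds the
boundary distance from below. The radius equation says that the two bounds agree. The function
`extremalFun`, whose coefficients are the extreme ones, attains the sum at every z = r > 0 and the
distance as z → −1, whence sharpness.

Write p = (z(zf')')'/(zg')', so that Re p > 0 and p(0) = 1/g'(0). The coefficient bound comes from
multiplying out p · (zg')' with Carathéodory's bound for p and Loewner's bound for g.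

The covering theorem takes three integrations. Lower bounds for |(zg')'| and Re(vp), |v| = 1, give
one for z(zf')' by a comparison along the flow of the starlike function zg'
(`le_norm_mul_re_of_starlike`). Path lifting then passes to zf' and to the values of f
(`le_norm_of_injOn`, `exists_preimage_of_norm_lt`). As g'(0) need not be real, v = 1 loses a factor
c = cos(arg g'(0)). The rotation that makes vp(0) positive gives instead, near the origin, the bound
for c = 1 plus (1 − c) times a polynomial, whose contribution is still positive after the last
integration.

Univalence of zf' makes path lifting a growth estimate; univalence of f ensures that its image has a
boundary. Both follow from Re((zf')'/g') > 0 with g convex. -/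

open Filter Topology

/-! ### Univalent functions: inverse and image -/

/-- An injective holomorphic function on the unit disc has open image, nonvanishing derivative and
a holomorphic inverse. -/
theorem exists_holomorphic_inverse {g : ℂ → ℂ} (hg : DifferentiableOn ℂ g (ball 0 1))
    (hi : InjOn g (ball 0 1)) :
    IsOpen (g '' ball 0 1) ∧ (∀ z ∈ ball (0 : ℂ) 1, deriv g z ≠ 0) ∧
      ∃ ψ : ℂ → ℂ, DifferentiableOn ℂ ψ (g '' ball 0 1) ∧ ∀ z ∈ ball (0 : ℂ) 1, ψ (g z) = z := by
  have hga : AnalyticOnNhd ℂ g (ball 0 1) := hg.analyticOnNhd isOpen_ball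
  have hopen : ∀ s ⊆ ball (0 : ℂ) 1, IsOpen s → IsOpen (g '' s) := by
    rcases hga.is_constant_or_isOpen (convex_ball 0 1).isPreconnected with ⟨w, hw⟩ | h
    · exfalso
      have h0 : (0 : ℂ) ∈ ball (0 : ℂ) 1 := by simp
      have h1 : (1 / 2 : ℂ) ∈ ball (0 : ℂ) 1 := by simp; norm_num
      have := hi h0 h1 (by rw [hw _ h0, hw _ h1])
      norm_num at this
    · exact h
  set ψ := Function.invFunOn g (ball 0 1) with hψ
  have hl : ∀ z ∈ ball (0 : ℂ) 1, ψ (g z) = z := fun z hz => hi.leftInvOn_invFunOn hz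
  have himg : IsOpen (g '' ball 0 1) := hopen _ Subset.rfl isOpen_ball
  have hcont : ContinuousOn ψ (g '' ball 0 1) := by
    rw [continuousOn_open_iff himg]
    intro V hV
    have : g '' ball 0 1 ∩ ψ ⁻¹' V = g '' (ball 0 1 ∩ V) := by
      ext w
      constructor
      · rintro ⟨⟨z, hz, rfl⟩, hw⟩
        exact ⟨z, ⟨hz, by simpa [hl z hz] using hw⟩, rfl⟩
      · rintro ⟨z, ⟨hz, hzV⟩, rfl⟩
        exact ⟨⟨z, hz, rfl⟩, by simpa [hl z hz] using hzV⟩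
    rw [this]
    exact hopen _ inter_subset_left (isOpen_ball.inter hV)
  have hd1 : ∀ z ∈ ball (0 : ℂ) 1, deriv g z ≠ 0 → DifferentiableAt ℂ ψ (g z) := by
    intro z hz hne
    have h1 : HasDerivAt g (deriv g z) (ψ (g z)) := by
      rw [hl z hz]
      exact (hg.differentiableAt (isOpen_ball.mem_nhds hz)).hasDerivAt
    refine (HasDerivAt.of_local_left_inverse (hcont.continuousAt
      (himg.mem_nhds ⟨z, hz, rfl⟩)) h1 hne ?_).differentiableAt
    filter_upwards [himg.mem_nhds ⟨z, hz, rfl⟩] with y hy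
    obtain ⟨x, hx, rfl⟩ := hy
    rw [hl x hx]
  -- Zeros of g' are isolated, because g is not locally constant. Off their images `ψ` is
  -- holomorphic and at them it is continuous, so these singularities are removable. The chain rule
  -- for ψ ∘ g then excludes zeros of g' altogether.
  have hd2 : ∀ z ∈ ball (0 : ℂ) 1, DifferentiableAt ℂ ψ (g z) := by
    intro z hz
    have hda : AnalyticAt ℂ (deriv g) z := (hga z hz).deriv
    rcases hda.eventually_eq_zero_or_eventually_ne_zero with h | h
    · exfalso
      obtain ⟨ε, hε, hball⟩ := Metric.eventually_nhds_iff_ball.1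
        (h.and (isOpen_ball.mem_nhds hz : ∀ᶠ y in 𝓝 z, y ∈ ball (0 : ℂ) 1))
      have hm : z + (ε / 2 : ℝ) ∈ ball z ε := by
        simp [abs_of_pos hε]; linarith
      have hc := isOpen_ball.is_const_of_deriv_eq_zero (convex_ball z ε).isPreconnected
        (hg.mono fun y hy => (hball y hy).2) (fun y hy => (hball y hy).1)
        (mem_ball_self hε) hm
      have h2 := hi (hball _ (mem_ball_self hε)).2 (hball _ hm).2 hc
      have : ((ε / 2 : ℝ) : ℂ) = 0 := by linear_combination -h2
      norm_cast at this
      linarith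
    · rw [eventually_nhdsWithin_iff] at h
      obtain ⟨ε, hε, hball⟩ := Metric.eventually_nhds_iff_ball.1
        (h.and (isOpen_ball.mem_nhds hz : ∀ᶠ y in 𝓝 z, y ∈ ball (0 : ℂ) 1))
      have hsub : ball z ε ⊆ ball 0 1 := fun y hy => (hball y hy).2
      have hs : g '' ball z ε ∈ 𝓝 (g z) :=
        (hopen _ hsub isOpen_ball).mem_nhds ⟨z, mem_ball_self hε, rfl⟩
      refine DifferentiableOn.differentiableAt
        ((Complex.differentiableOn_compl_singleton_and_continuousAt_iff hs).1 ⟨?_, ?_⟩) hs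
      · rintro _ ⟨⟨y, hy, rfl⟩, hne⟩
        refine (hd1 y (hsub hy) ((hball y hy).1 ?_)).differentiableWithinAt
        rintro rfl
        exact hne rfl
      · exact hcont.continuousAt (himg.mem_nhds ⟨z, hz, rfl⟩)
  refine ⟨himg, fun z hz h0 => ?_, ψ, ?_, hl⟩
  · have h1 : HasDerivAt g (deriv g z) z :=
      (hg.differentiableAt (isOpen_ball.mem_nhds hz)).hasDerivAt
    have h2 := (hd2 z hz).hasDerivAt.comp z h1
    have h3 : HasDerivAt (ψ ∘ g) 1 z := by
      refine (hasDerivAt_id z).congr_of_eventuallyEq ?_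
      filter_upwards [isOpen_ball.mem_nhds hz] with y hy
      simp [hl y hy]
    have := h2.unique h3
    simp [h0] at this
  · rintro _ ⟨z, hz, rfl⟩
    exact (hd2 z hz).differentiableWithinAt

/-- The image of an injective holomorphic function on the disc is not the whole plane. -/
theorem image_ball_ne_univ {g : ℂ → ℂ} (hg : DifferentiableOn ℂ g (ball 0 1))
    (hi : InjOn g (ball 0 1)) : g '' ball 0 1 ≠ univ := by
  intro h
  obtain ⟨-, -, ψ, hψ, hl⟩ := exists_holomorphic_inverse hg hi
  rw [h] at hψ
  have hb : Bornology.IsBounded (range ψ) := by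
    refine isBounded_ball.subset (s := range ψ) (t := ball (0 : ℂ) 1) ?_
    rintro _ ⟨w, rfl⟩
    obtain ⟨z, hz, rfl⟩ : w ∈ g '' ball 0 1 := h ▸ mem_univ w
    rwa [hl z hz]
  have hc := (differentiableOn_univ.1 hψ).apply_eq_apply_of_bounded hb (g 0) (g (1 / 2))
  have h1 : (1 / 2 : ℂ) ∈ ball (0 : ℂ) 1 := by simp; norm_num
  rw [hl 0 (by simp), hl _ h1] at hc
  norm_num at hc

/-! ### Functions with nonnegative real part -/

/-- Schwarz's lemma for functions with nonnegative real part. -/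
theorem norm_sub_one_le_of_re_nonneg {P : ℂ → ℂ} (hP : DifferentiableOn ℂ P (ball 0 1))
    (h0 : P 0 = 1) (hre : ∀ z ∈ ball (0 : ℂ) 1, 0 ≤ (P z).re) {z : ℂ} (hz : z ∈ ball (0 : ℂ) 1) :
    ‖P z - 1‖ ≤ ‖z‖ * ‖P z + 1‖ := by
  have hne : ∀ z ∈ ball (0 : ℂ) 1, P z + 1 ≠ 0 := by
    intro z hz h
    have h1 := hre z hz
    have := congrArg Complex.re h
    simp at this
    linarith
  have key : ‖(P z - 1) / (P z + 1)‖ ≤ ‖z‖ := by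
    -- Schwarz's lemma for the Cayley transform (P − 1)/(P + 1), which has modulus at most 1 when Re
    -- P ≥ 0.
    refine Complex.norm_le_norm_of_mapsTo_ball (R := 1) (f := fun z => (P z - 1) / (P z + 1))
      ((hP.sub_const 1).div (hP.add_const 1) hne) ?_ (by simp [h0]) (by simpa using hz)
    intro w hw
    have h1 := hre w hw
    rw [mem_closedBall_zero_iff, norm_div, div_le_one (norm_pos_iff.2 (hne w hw))]
    rw [← sq_le_sq₀ (norm_nonneg _) (norm_nonneg _), Complex.sq_norm, Complex.sq_norm,
      Complex.normSq_apply, Complex.normSq_apply]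
    simp
    nlinarith
  rwa [norm_div, div_le_iff₀ (norm_pos_iff.2 (hne z hz))] at key

/-- The bound `|P - 1| ≤ s |P + 1|` describes a disc. -/
theorem norm_sub_center_le {w : ℂ} {s : ℝ} (hs0 : 0 ≤ s) (hs : s < 1) (h : ‖w - 1‖ ≤ s * ‖w + 1‖) :
    ‖w - ((1 + s ^ 2) / (1 - s ^ 2) : ℝ)‖ ≤ 2 * s / (1 - s ^ 2) := by
  have hd : 0 < 1 - s ^ 2 := by nlinarith
  have h2 : ‖w - 1‖ ^ 2 ≤ s ^ 2 * ‖w + 1‖ ^ 2 := by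
    rw [← mul_pow]; gcongr
  rw [Complex.sq_norm, Complex.sq_norm, Complex.normSq_apply, Complex.normSq_apply] at h2
  simp at h2
  refine abs_le_of_sq_le_sq' ?_ (by positivity) |>.2
  rw [Complex.sq_norm, Complex.normSq_apply, div_pow, le_div_iff₀ (by positivity)]
  have e : (w - ((1 + s ^ 2) / (1 - s ^ 2) : ℝ)).re
      = (w.re * (1 - s ^ 2) - (1 + s ^ 2)) / (1 - s ^ 2) := by
    rw [Complex.sub_re, Complex.ofReal_re]
    field_simp
  have e2 : (w - ((1 + s ^ 2) / (1 - s ^ 2) : ℝ)).im = w.im := by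
    rw [Complex.sub_im, Complex.ofReal_im, sub_zero]
  rw [e, e2]
  have : ((w.re * (1 - s ^ 2) - (1 + s ^ 2)) / (1 - s ^ 2)
      * ((w.re * (1 - s ^ 2) - (1 + s ^ 2)) / (1 - s ^ 2)) + w.im * w.im) * (1 - s ^ 2) ^ 2
      = (w.re * (1 - s ^ 2) - (1 + s ^ 2)) ^ 2 + (w.im * (1 - s ^ 2)) ^ 2 := by
    field_simp
  rw [this]
  nlinarith [mul_nonneg hd.le (sub_nonneg.2 h2)]

/-- Lower bounds in the disc `|w - 1| ≤ s |w + 1|`. -/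
theorem le_re_of_norm_sub_one_le {w : ℂ} {s : ℝ} (hs0 : 0 ≤ s) (hs : s < 1)
    (h : ‖w - 1‖ ≤ s * ‖w + 1‖) : (1 - s) / (1 + s) ≤ w.re := by
  have h1 := norm_sub_center_le hs0 hs h
  have h2 := (abs_le.1 ((Complex.abs_re_le_norm _).trans h1)).1
  rw [Complex.sub_re, Complex.ofReal_re] at h2
  have hd : 0 < 1 - s ^ 2 := by nlinarith
  have : (1 - s) / (1 + s) = (1 + s ^ 2) / (1 - s ^ 2) - 2 * s / (1 - s ^ 2) := by
    have : (1 - s ^ 2) = (1 - s) * (1 + s) := by ring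
    have h3 : 1 - s ≠ 0 := by linarith
    have h4 : 1 + s ≠ 0 := by linarith
    rw [this]
    field_simp
    ring
  linarith

theorem taylorCoeff_eq_circleAverage {p : ℂ → ℂ} (hp : DifferentiableOn ℂ p (ball 0 1)) {r : ℝ}
    (hr0 : 0 < r) (hr : r < 1) (n : ℕ) :
    taylorCoeff p n = Real.circleAverage (fun z => z⁻¹ ^ n * p z) 0 r := by
  lift r to NNReal using hr0.le
  have hps := (hp.mono (closedBall_subset_ball hr)).hasFPowerSeriesOnBall (R := r)
    (by exact_mod_cast hr0)
  have h := hps.factorial_smul 1 n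
  rw [← iteratedDeriv_eq_iteratedFDeriv] at h
  rw [taylorCoeff, ← h, cauchyPowerSeries_apply, Real.circleAverage_eq_circleIntegral hr0.ne']
  rw [nsmul_eq_mul, mul_div_cancel_left₀ _ (by exact_mod_cast n.factorial_ne_zero)]
  congr 2
  ext z
  simp
  ring

theorem circleAverage_pow_mul_eq_zero {p : ℂ → ℂ} (hp : DifferentiableOn ℂ p (ball 0 1)) {r : ℝ}
    (hr0 : 0 < r) (hr : r < 1) {n : ℕ} (hn : n ≠ 0) :
    Real.circleAverage (fun z => z ^ n * p z) 0 r = 0 := by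
  have hd : DiffContOnCl ℂ (fun z => z ^ n * p z) (ball 0 |r|) := by
    refine DifferentiableOn.diffContOnCl ?_
    rw [abs_of_pos hr0, closure_ball _ hr0.ne']
    exact (differentiableOn_pow n).mul (hp.mono (closedBall_subset_ball hr))
  rw [hd.circleAverage]
  simp [hn]

open Real in
/-- Carathéodory's coefficient bound, on a circle of radius `r < 1`. -/
theorem norm_taylorCoeff_mul_pow_le {p : ℂ → ℂ} (hp : DifferentiableOn ℂ p (ball 0 1))
    (hre : ∀ z ∈ ball (0 : ℂ) 1, 0 ≤ (p z).re) {r : ℝ} (hr0 : 0 < r) (hr : r < 1) {n : ℕ}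
    (hn : n ≠ 0) : ‖taylorCoeff p n‖ * r ^ n ≤ 2 * (p 0).re := by
  have hsub : closedBall (0 : ℂ) r ⊆ ball 0 1 := closedBall_subset_ball hr
  have hsph : ∀ θ, circleMap 0 r θ ∈ ball (0 : ℂ) 1 := fun θ =>
    hsub (circleMap_mem_closedBall 0 hr0.le θ)
  have hpc : Continuous fun θ => p (circleMap 0 r θ) :=
    continuous_iff_continuousAt.2 fun θ =>
      (hp.differentiableAt (isOpen_ball.mem_nhds (hsph θ))).continuousAt.comp
        (continuous_circleMap 0 r).continuousAt
  -- On the circle the weight conj(z)ⁿ equals r²ⁿ z⁻ⁿ, so it extracts the n-th coefficient from p.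
  -- Against conj(p) it is the conjugate of zⁿp, whose mean is 0. Adding the two replaces p by 2 Re
  -- p ≥ 0, whose mean is known.
  set u : ℝ → ℂ := fun θ => starRingEnd ℂ (circleMap 0 r θ) ^ n with hu
  have huc : Continuous u := (Complex.continuous_conj.comp (continuous_circleMap 0 r)).pow n
  have hun : ∀ θ, ‖u θ‖ = r ^ n := fun θ => by simp [hu, abs_of_pos hr0]
  have hinv : ∀ θ, u θ = (r : ℂ) ^ (2 * n) * (circleMap 0 r θ)⁻¹ ^ n := fun θ => by
    have h1 : starRingEnd ℂ (circleMap 0 r θ) * circleMap 0 r θ = (r : ℂ) ^ 2 := by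
      rw [mul_comm, Complex.mul_conj, Complex.normSq_eq_norm_sq]
      simp
    have h2 : circleMap 0 r θ ≠ 0 := circleMap_ne_center hr0.ne'
    simp only [hu]
    rw [pow_mul, ← h1, ← mul_pow, mul_assoc, mul_inv_cancel₀ h2, mul_one]
  have i1 : (r : ℂ) ^ (2 * n) * taylorCoeff p n
      = (2 * π : ℝ)⁻¹ • ∫ θ in (0 : ℝ)..2 * π, u θ * p (circleMap 0 r θ) := by
    rw [taylorCoeff_eq_circleAverage hp hr0 hr, circleAverage_def, mul_smul_comm,
      ← intervalIntegral.integral_const_mul]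
    congr 2
    ext θ
    rw [hinv, mul_assoc]
  have i2 : (2 * π : ℝ)⁻¹ • ∫ θ in (0 : ℝ)..2 * π,
      u θ * starRingEnd ℂ (p (circleMap 0 r θ)) = 0 := by
    have h := congrArg (starRingEnd ℂ) (circleAverage_pow_mul_eq_zero hp hr0 hr hn)
    rw [circleAverage_def, map_zero, Complex.real_smul, map_mul, Complex.conj_ofReal,
      ← Complex.real_smul] at h
    refine Eq.trans ?_ h
    congr 1
    rw [← Complex.conjCLE_apply, ← ContinuousLinearEquiv.coe_coe,
      ← ContinuousLinearMap.intervalIntegral_comp_comm]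
    · congr 1
      ext θ
      simp [hu]
    · exact (((continuous_circleMap 0 r).pow n).mul hpc).intervalIntegrable _ _
  have i3 : (r : ℂ) ^ (2 * n) * taylorCoeff p n
      = (2 * π : ℝ)⁻¹ • ∫ θ in (0 : ℝ)..2 * π, u θ * (2 * (p (circleMap 0 r θ)).re : ℝ) := by
    have h : ∀ θ, u θ * (2 * (p (circleMap 0 r θ)).re : ℝ)
        = u θ * p (circleMap 0 r θ) + u θ * starRingEnd ℂ (p (circleMap 0 r θ)) := fun θ => by
      rw [← mul_add, Complex.add_conj]
    have c1 : Continuous fun θ => u θ * p (circleMap 0 r θ) := huc.mul hpc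
    have c2 : Continuous fun θ => u θ * starRingEnd ℂ (p (circleMap 0 r θ)) :=
      huc.mul (Complex.continuous_conj.comp hpc)
    simp_rw [h]
    rw [intervalIntegral.integral_add (c1.intervalIntegrable _ _)
      (c2.intervalIntegrable _ _), smul_add, i2, add_zero, i1]
  have hmean : (2 * π)⁻¹ * ∫ θ in (0 : ℝ)..2 * π, (p (circleMap 0 r θ)).re = (p 0).re := by
    have hd : DiffContOnCl ℂ p (ball 0 |r|) := by
      refine DifferentiableOn.diffContOnCl ?_
      rw [abs_of_pos hr0, closure_ball _ hr0.ne']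
      exact hp.mono hsub
    have h := congrArg Complex.re hd.circleAverage
    rw [circleAverage_def, Complex.smul_re, smul_eq_mul] at h
    rw [← h]
    congr 1
    exact Complex.reCLM.intervalIntegral_comp_comm (hpc.intervalIntegrable _ _)
  have hb : ‖∫ θ in (0 : ℝ)..2 * π, u θ * (2 * (p (circleMap 0 r θ)).re : ℝ)‖
      ≤ ∫ θ in (0 : ℝ)..2 * π, r ^ n * (2 * (p (circleMap 0 r θ)).re) := by
    refine (intervalIntegral.norm_integral_le_integral_norm (by positivity)).trans_eq ?_
    congr 1
    ext θ
    rw [norm_mul, hun, Complex.norm_real, Real.norm_of_nonneg]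
    have := hre _ (hsph θ)
    positivity
  have h4 : r ^ (2 * n) * ‖taylorCoeff p n‖ ≤ r ^ n * (2 * (p 0).re) := by
    have := congrArg norm i3
    rw [norm_mul, norm_pow, Complex.norm_real, Real.norm_of_nonneg hr0.le, norm_smul,
      Real.norm_of_nonneg (by positivity)] at this
    rw [this]
    calc _ ≤ (2 * π)⁻¹ * ∫ θ in (0 : ℝ)..2 * π, r ^ n * (2 * (p (circleMap 0 r θ)).re) := by
          gcongr
      _ = r ^ n * (2 * ((2 * π)⁻¹ * ∫ θ in (0 : ℝ)..2 * π, (p (circleMap 0 r θ)).re)) := by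
          rw [intervalIntegral.integral_const_mul, intervalIntegral.integral_const_mul]
          ring
      _ = _ := by rw [hmean]
  have hrn : 0 < r ^ n := by positivity
  rw [two_mul n, pow_add] at h4
  nlinarith

/-- **Carathéodory's inequality** for the Taylor coefficients of a function with nonnegative
real part. -/
theorem norm_taylorCoeff_le_of_re_nonneg {p : ℂ → ℂ} (hp : DifferentiableOn ℂ p (ball 0 1))
    (hre : ∀ z ∈ ball (0 : ℂ) 1, 0 ≤ (p z).re) {n : ℕ} (hn : n ≠ 0) :
    ‖taylorCoeff p n‖ ≤ 2 * (p 0).re := by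
  have ht : Tendsto (fun r : ℝ => ‖taylorCoeff p n‖ * r ^ n) (𝓝[<] 1)
      (𝓝 (‖taylorCoeff p n‖ * 1 ^ n)) :=
    ((continuous_const.mul (continuous_pow n)).tendsto 1).mono_left nhdsWithin_le_nhds
  rw [one_pow, mul_one] at ht
  refine le_of_tendsto ht ?_
  filter_upwards [Ioo_mem_nhdsLT (show (0 : ℝ) < 1 by norm_num)] with r hr
  exact norm_taylorCoeff_mul_pow_le hp hre hr.1 hr.2 hn

/-! ### Taylor coefficients -/

theorem taylorCoeff_zero (f : ℂ → ℂ) : taylorCoeff f 0 = f 0 := by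
  simp [taylorCoeff]

theorem taylorCoeff_one (f : ℂ → ℂ) : taylorCoeff f 1 = deriv f 0 := by
  simp [taylorCoeff]

theorem taylorCoeff_deriv (f : ℂ → ℂ) (n : ℕ) :
    taylorCoeff (deriv f) n = (n + 1) * taylorCoeff f (n + 1) := by
  simp only [taylorCoeff, ← iteratedDeriv_succ', Nat.factorial_succ]
  have : ((n + 1 : ℕ) : ℂ) ≠ 0 := by exact_mod_cast n.succ_ne_zero
  have h2 : (n.factorial : ℂ) ≠ 0 := by exact_mod_cast n.factorial_ne_zero
  push_cast at this ⊢
  field_simp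

theorem taylorCoeff_congr {f g : ℂ → ℂ} (h : EqOn f g (ball 0 1)) (n : ℕ) :
    taylorCoeff f n = taylorCoeff g n := by
  rw [taylorCoeff, taylorCoeff, Filter.EventuallyEq.iteratedDeriv_eq n
    (h.eventuallyEq_of_mem (ball_mem_nhds 0 one_pos))]

theorem contDiffAt_of_differentiableOn_ball {f : ℂ → ℂ} (hf : DifferentiableOn ℂ f (ball 0 1))
    (n : WithTop ℕ∞) : ContDiffAt ℂ n f 0 :=
  (hf.analyticAt (ball_mem_nhds 0 one_pos)).contDiffAt

theorem taylorCoeff_mul {f g : ℂ → ℂ} (hf : DifferentiableOn ℂ f (ball 0 1))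
    (hg : DifferentiableOn ℂ g (ball 0 1)) (n : ℕ) :
    taylorCoeff (fun z => f z * g z) n
      = ∑ i ∈ Finset.range (n + 1), taylorCoeff f i * taylorCoeff g (n - i) := by
  simp only [taylorCoeff]
  rw [iteratedDeriv_fun_mul (contDiffAt_of_differentiableOn_ball hf _)
    (contDiffAt_of_differentiableOn_ball hg _), Finset.sum_div]
  refine Finset.sum_congr rfl fun i hi => ?_
  have hi' : i ≤ n := Nat.lt_succ_iff.1 (Finset.mem_range.1 hi)
  have h1 : (i.factorial : ℂ) ≠ 0 := by exact_mod_cast i.factorial_ne_zero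
  have h2 : ((n - i).factorial : ℂ) ≠ 0 := by exact_mod_cast (n - i).factorial_ne_zero
  have h3 : (n.factorial : ℂ) ≠ 0 := by exact_mod_cast n.factorial_ne_zero
  rw [Nat.cast_choose ℂ hi']
  field_simp

theorem differentiableOn_deriv {f : ℂ → ℂ} (hf : DifferentiableOn ℂ f (ball 0 1)) :
    DifferentiableOn ℂ (deriv f) (ball 0 1) := hf.deriv isOpen_ball

theorem differentiableOn_eulerOp {f : ℂ → ℂ} (hf : DifferentiableOn ℂ f (ball 0 1)) :
    DifferentiableOn ℂ (eulerOp f) (ball 0 1) :=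
  differentiableOn_id.mul (differentiableOn_deriv hf)

theorem taylorCoeff_eulerOp {f : ℂ → ℂ} (hf : DifferentiableOn ℂ f (ball 0 1)) (n : ℕ) :
    taylorCoeff (eulerOp f) n = n * taylorCoeff f n := by
  cases n with
  | zero => simp [taylorCoeff_zero, eulerOp]
  | succ n =>
    have h := taylorCoeff_mul differentiableOn_id (differentiableOn_deriv hf) (n + 1)
    have h1 : ∀ i, taylorCoeff id i = if i = 1 then 1 else 0 := fun i => by
      simp only [taylorCoeff, iteratedDeriv_id]
      rcases i with _ | _ | i <;> simp
    have h2 : taylorCoeff (eulerOp f) (n + 1)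
        = taylorCoeff (fun z => id z * deriv f z) (n + 1) := rfl
    rw [h2, h, Finset.sum_eq_single 1]
    · simp [h1, taylorCoeff_deriv]
    · intro i _ hi
      simp [h1, hi]
    · simp

theorem hasSum_taylorCoeff {f : ℂ → ℂ} (hf : DifferentiableOn ℂ f (ball 0 1)) {z : ℂ}
    (hz : z ∈ ball (0 : ℂ) 1) : HasSum (fun n => taylorCoeff f n * z ^ n) (f z) := by
  have h := Complex.hasSum_taylorSeries_on_ball hf hz
  have e : (fun n : ℕ => taylorCoeff f n * z ^ n)
      = fun n : ℕ => (n.factorial : ℂ)⁻¹ • (z - 0) ^ n • iteratedDeriv n f 0 := by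
    ext n
    simp only [taylorCoeff, sub_zero, smul_eq_mul]
    ring
  rwa [e]

/-! ### Comparison along flows and lifted paths -/

theorem eventually_lt_of_hasDerivWithinAt_neg {φ : ℝ → ℝ} {d : ℝ}
    (h : HasDerivWithinAt φ d (Ioi 0) 0)
    (hd : d < 0) : ∀ᶠ t in 𝓝[>] (0 : ℝ), φ t < φ 0 := by
  rw [hasDerivWithinAt_iff_tendsto_slope' (by simp)] at h
  filter_upwards [h.eventually (gt_mem_nhds hd), self_mem_nhdsWithin] with t ht (ht0 : 0 < t)
  rw [slope_def_field, sub_zero, div_lt_iff₀ ht0] at ht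
  linarith

theorem hasDerivAt_norm_curve {w : ℝ → ℂ} {w' : ℂ} {t : ℝ} (h : HasDerivAt w w' t)
    (h0 : w t ≠ 0) : HasDerivAt (fun s => ‖w s‖) ((starRingEnd ℂ (w t) * w').re / ‖w t‖) t := by
  have hn : 0 < ‖w t‖ := norm_pos_iff.2 h0
  have h1 := h.norm_sq.sqrt (by positivity)
  simp only [Real.sqrt_sq (norm_nonneg _)] at h1
  convert h1 using 1
  rw [Complex.inner]
  field_simp

/-- A lower bound for `Re (v̄ X / h)` with `h` starlike, obtained from a lower bound for
`Re (v̄ X' / h')`: the function `|h| Re (v̄ X / h) - T(|z|)` increases along the flow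
`z' = h(z) / h'(z)`, so it is smallest at the origin. -/
theorem le_norm_mul_re_of_starlike {h X : ℂ → ℂ} (hh : DifferentiableOn ℂ h (ball 0 1))
    (hX : DifferentiableOn ℂ X (ball 0 1)) (h0 : h 0 = 0) (X0 : X 0 = 0)
    (hst : ∀ z ∈ ball (0 : ℂ) 1, z ≠ 0 → 0 < (z * deriv h z / h z).re)
    {v : ℂ} {ρ : ℝ} (hρ : ρ < 1) {T T' : ℝ → ℝ} (T0 : T 0 = 0) (hTc : ContinuousOn T (Icc 0 ρ))
    (hT : ∀ s ∈ Ioc 0 ρ, HasDerivAt T (T' s) s) (hT' : ∀ s ∈ Ioc 0 ρ, 0 ≤ T' s)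
    (hb : ∀ z ≠ 0, ‖z‖ ≤ ρ → T' ‖z‖ ≤ ‖deriv h z‖ * (v * (deriv X z / deriv h z)).re)
    {z : ℂ} (hz : ‖z‖ ≤ ρ) : T ‖z‖ ≤ ‖h z‖ * (v * (X z / h z)).re := by
  have hsub : closedBall (0 : ℂ) ρ ⊆ ball 0 1 := closedBall_subset_ball hρ
  have hne : ∀ z ∈ ball (0 : ℂ) 1, z ≠ 0 → h z ≠ 0 ∧ deriv h z ≠ 0 := by
    intro z hz hz0
    have := hst z hz hz0
    constructor <;> intro h' <;> simp [h'] at this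
  -- The term ε|h| makes the decrease along the inward flow strict, which rules out a minimum off
  -- the origin.
  suffices H : ∀ ε > 0, T ‖z‖ ≤ ‖h z‖ * (v * (X z / h z)).re + ε * ‖h z‖ by
    refine le_of_forall_pos_le_add fun δ hδ => ?_
    have hp : 0 < ‖h z‖ + 1 := by positivity
    refine (H (δ / (‖h z‖ + 1)) (by positivity)).trans ?_
    gcongr
    rw [div_mul_eq_mul_div, div_le_iff₀ hp]
    nlinarith [norm_nonneg (h z)]
  intro ε hε
  set E : ℂ → ℝ := fun z => ‖h z‖ * (v * (X z / h z)).re + ε * ‖h z‖ - T ‖z‖ with hE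
  have hcont : ContinuousOn E (closedBall 0 ρ) := by
    have c1 : ContinuousOn h (closedBall 0 ρ) := hh.continuousOn.mono hsub
    have c2 : ContinuousOn X (closedBall 0 ρ) := hX.continuousOn.mono hsub
    refine ContinuousOn.sub (ContinuousOn.add ?_ (c1.norm.const_smul ε)) ?_
    · intro y hy
      rcases eq_or_ne y 0 with rfl | hy0
      -- At the origin X/h is 0/0 = 0 by convention; continuity there comes from |h| |X/h| ≤ |X| →
      -- 0.
      · have hlim : Tendsto (fun z => ‖v‖ * ‖X z‖) (𝓝[closedBall 0 ρ] 0) (𝓝 0) := by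
          have : Tendsto (fun z => ‖v‖ * ‖X z‖) (𝓝[closedBall 0 ρ] 0) (𝓝 (‖v‖ * ‖X 0‖)) :=
            tendsto_const_nhds.mul (c2 0 hy).norm.tendsto
          rw [X0, norm_zero, mul_zero] at this
          exact this
        have : ContinuousWithinAt (fun z => ‖h z‖ * (v * (X z / h z)).re) (closedBall 0 ρ) 0 := by
          rw [ContinuousWithinAt, h0, norm_zero, zero_mul]
          refine squeeze_zero_norm (fun z => ?_) hlim
          rw [norm_mul, norm_norm]
          calc ‖h z‖ * ‖(v * (X z / h z)).re‖ ≤ ‖h z‖ * ‖v * (X z / h z)‖ := by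
                gcongr; exact Complex.abs_re_le_norm _
            _ = ‖v‖ * (‖X z‖ * (‖h z‖ / ‖h z‖)) := by rw [norm_mul, norm_div]; ring
            _ ≤ ‖v‖ * (‖X z‖ * 1) := by gcongr; exact div_self_le_one _
            _ = _ := by rw [mul_one]
        exact this
      · have hn := (hne y (hsub hy) hy0).1
        exact ((c1 y hy).norm.mul (Complex.continuous_re.continuousAt.comp_continuousWithinAt
          (continuousWithinAt_const.mul ((c2 y hy).div (c1 y hy) hn))))
    · exact hTc.comp continuous_norm.continuousOn fun y hy =>
        ⟨norm_nonneg _, mem_closedBall_zero_iff.1 hy⟩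
  obtain ⟨z₀, hz₀, hmin⟩ := (isCompact_closedBall (0 : ℂ) ρ).exists_isMinOn
    ⟨0, by simpa using (norm_nonneg z).trans hz⟩ hcont
  have hE0 : E 0 = 0 := by simp [hE, h0, T0]
  suffices hz0 : z₀ = 0 by
    have : E 0 ≤ E z := hz0 ▸ hmin (by simpa using hz)
    rw [hE0] at this
    simp only [hE] at this
    linarith
  by_contra hz00
  have hzb : z₀ ∈ ball (0 : ℂ) 1 := hsub hz₀
  obtain ⟨hn, hdn⟩ := hne z₀ hzb hz00
  set lam : ℂ := h z₀ / (z₀ * deriv h z₀) with hlam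
  have hlre : 0 < lam.re := by
    have h1 := hst z₀ hzb hz00
    have : lam = (z₀ * deriv h z₀ / h z₀)⁻¹ := by rw [inv_div]
    rw [this, Complex.inv_re]
    exact div_pos h1 (Complex.normSq_pos.2 (div_ne_zero (mul_ne_zero hz00 hdn) hn))
  -- To first order this straight step is the inward flow: h keeps its argument, |h| falls at rate
  -- |h|, and |z| falls at rate |z| Re λ, which is positive by starlikeness.
  set γ : ℝ → ℂ := fun t => z₀ - t * (h z₀ / deriv h z₀) with hγ
  have hγ0 : γ 0 = z₀ := by simp [hγ]
  have hγd : HasDerivAt γ (-(h z₀ / deriv h z₀)) 0 := by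
    have := ((hasDerivAt_id (0 : ℝ)).ofReal_comp.mul_const (h z₀ / deriv h z₀)).const_sub z₀
    simpa [hγ] using this
  have hzl : h z₀ / deriv h z₀ = z₀ * lam := by rw [hlam]; field_simp
  have dh : HasDerivAt (fun t => h (γ t)) (-h z₀) 0 := by
    have h1 : HasDerivAt h (deriv h z₀) (γ 0) := by
      rw [hγ0]; exact (hh.differentiableAt (isOpen_ball.mem_nhds hzb)).hasDerivAt
    have e : -h z₀ = deriv h z₀ * -(h z₀ / deriv h z₀) := by field_simp
    rw [e]
    exact h1.comp 0 hγd
  have dX : HasDerivAt (fun t => X (γ t)) (deriv X z₀ * -(h z₀ / deriv h z₀)) 0 := by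
    have h1 : HasDerivAt X (deriv X z₀) (γ 0) := by
      rw [hγ0]; exact (hX.differentiableAt (isOpen_ball.mem_nhds hzb)).hasDerivAt
    exact h1.comp 0 hγd
  have dn : HasDerivAt (fun t => ‖h (γ t)‖) (-‖h z₀‖) 0 := by
    have := hasDerivAt_norm_curve dh (by rwa [hγ0])
    convert this using 1
    rw [hγ0, mul_neg, mul_comm, Complex.mul_conj, Complex.normSq_eq_norm_sq, Complex.neg_re,
      Complex.ofReal_re]
    have : ‖h z₀‖ ≠ 0 := norm_ne_zero_iff.2 hn
    field_simp
  have dz : HasDerivAt (fun t => ‖γ t‖) (-(‖z₀‖ * lam.re)) 0 := by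
    have := hasDerivAt_norm_curve hγd (by rwa [hγ0])
    convert this using 1
    rw [hγ0, hzl, mul_neg, ← mul_assoc, mul_comm (starRingEnd ℂ z₀), Complex.mul_conj,
      Complex.normSq_eq_norm_sq, Complex.neg_re, Complex.re_ofReal_mul]
    have : ‖z₀‖ ≠ 0 := norm_ne_zero_iff.2 hz00
    field_simp
  have dq : HasDerivAt (fun t => (v * (X (γ t) / h (γ t))).re)
      (v * (X z₀ / h z₀ - deriv X z₀ / deriv h z₀)).re 0 := by
    have h1 := (dX.div dh (by rwa [hγ0])).const_mul v
    have h2 := Complex.reCLM.hasFDerivAt.comp_hasDerivAt 0 h1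
    have e : (v * (X z₀ / h z₀ - deriv X z₀ / deriv h z₀)).re = Complex.reCLM (v * ((deriv X z₀ *
        -(h z₀ / deriv h z₀) * h (γ 0) - X (γ 0) * -h z₀) / h (γ 0) ^ 2)) := by
      rw [hγ0, Complex.reCLM_apply]
      congr 2
      field_simp
      ring
    rw [e]
    exact h2
  have hzn : ‖z₀‖ ∈ Ioc 0 ρ := ⟨norm_pos_iff.2 hz00, mem_closedBall_zero_iff.1 hz₀⟩
  have dT : HasDerivAt (fun t => T ‖γ t‖) (T' ‖z₀‖ * -(‖z₀‖ * lam.re)) 0 := by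
    have h1 : HasDerivAt T (T' ‖z₀‖) ‖γ 0‖ := by rw [hγ0]; exact hT _ hzn
    exact h1.comp 0 dz
  have dE := ((dn.mul dq).add (dn.const_mul ε)).sub dT
  have hneg : -‖h z₀‖ * (v * (X (γ 0) / h (γ 0))).re
      + ‖h (γ 0)‖ * (v * (X z₀ / h z₀ - deriv X z₀ / deriv h z₀)).re + ε * -‖h z₀‖
      - T' ‖z₀‖ * -(‖z₀‖ * lam.re) < 0 := by
    rw [hγ0, mul_sub, Complex.sub_re]
    have h1 := hb z₀ hz00 hzn.2
    have hdp : 0 < ‖deriv h z₀‖ := norm_pos_iff.2 hdn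
    have hhp : 0 < ‖h z₀‖ := norm_pos_iff.2 hn
    -- The modulus changes no faster than the point moves. With the bound on T', the loss of T is
    -- therefore at most that of |h| Re(vX/h), which is |h| Re(vX'/h').
    have h2 : ‖z₀‖ * lam.re ≤ ‖h z₀‖ / ‖deriv h z₀‖ := by
      rw [← norm_div, hzl, norm_mul]
      gcongr
      exact Complex.re_le_norm _
    have h3 : T' ‖z₀‖ * (‖z₀‖ * lam.re) ≤ ‖h z₀‖ * (v * (deriv X z₀ / deriv h z₀)).re := by
      calc _ ≤ T' ‖z₀‖ * (‖h z₀‖ / ‖deriv h z₀‖) := by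
            gcongr; exact hT' _ hzn
        _ ≤ (‖deriv h z₀‖ * (v * (deriv X z₀ / deriv h z₀)).re) * (‖h z₀‖ / ‖deriv h z₀‖) := by
            gcongr
        _ = _ := by field_simp
    nlinarith
  have e1 := eventually_lt_of_hasDerivWithinAt_neg dE.hasDerivWithinAt hneg
  have e2 := eventually_lt_of_hasDerivWithinAt_neg dz.hasDerivWithinAt
    (neg_lt_zero.2 (mul_pos hzn.1 hlre))
  obtain ⟨t, ht1, ht2⟩ := (e1.and e2).exists
  rw [hγ0] at ht2
  have hm : E z₀ ≤ E (γ t) := hmin (mem_closedBall_zero_iff.2 (ht2.le.trans hzn.2))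
  have ht3 : E (γ t) < E (γ 0) := by simpa [hE] using ht1
  rw [hγ0] at ht3
  linarith

/-- Libera's lemma: `Re (X'/h') > 0` with `h` starlike implies `Re (X/h) > 0`. -/
theorem re_div_pos_of_starlike {h X : ℂ → ℂ} (hh : DifferentiableOn ℂ h (ball 0 1))
    (hX : DifferentiableOn ℂ X (ball 0 1)) (h0 : h 0 = 0) (X0 : X 0 = 0)
    (hst : ∀ z ∈ ball (0 : ℂ) 1, z ≠ 0 → 0 < (z * deriv h z / h z).re)
    (hp : ∀ z ∈ ball (0 : ℂ) 1, 0 < (deriv X z / deriv h z).re)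
    {z : ℂ} (hz : z ∈ ball (0 : ℂ) 1) (hz0 : z ≠ 0) : 0 < (X z / h z).re := by
  have hz1 : ‖z‖ < 1 := mem_ball_zero_iff.1 hz
  have hsub : closedBall (0 : ℂ) ‖z‖ ⊆ ball 0 1 := closedBall_subset_ball hz1
  have hdn : ∀ z ∈ ball (0 : ℂ) 1, deriv h z ≠ 0 := by
    intro z hz h'
    have := hp z hz
    simp [h'] at this
  have c1 : ContinuousOn (deriv h) (closedBall 0 ‖z‖) :=
    (differentiableOn_deriv hh).continuousOn.mono hsub
  have c2 : ContinuousOn (deriv X) (closedBall 0 ‖z‖) :=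
    (differentiableOn_deriv hX).continuousOn.mono hsub
  -- On the compact disc |h'| Re(X'/h') has a positive minimum m, so the comparison applies with
  -- T(s) = ms.
  obtain ⟨y, hy, hmin⟩ := (isCompact_closedBall (0 : ℂ) ‖z‖).exists_isMinOn
    ⟨0, by simp⟩ (f := fun z => ‖deriv h z‖ * (deriv X z / deriv h z).re)
    (c1.norm.mul (Complex.continuous_re.comp_continuousOn
      (c2.div c1 fun y hy => hdn y (hsub hy))))
  set m := ‖deriv h y‖ * (deriv X y / deriv h y).re
  have hm : 0 < m := mul_pos (norm_pos_iff.2 (hdn y (hsub hy))) (hp y (hsub hy))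
  have key := le_norm_mul_re_of_starlike hh hX h0 X0 hst (v := 1) (ρ := ‖z‖) hz1
    (T := fun s => m * s) (T' := fun _ => m) (by simp) (by fun_prop)
    (fun s _ => by simpa using (hasDerivAt_id s).const_mul m) (fun _ _ => hm.le)
    (fun w _ hw => by
      rw [one_mul]
      exact hmin (mem_closedBall_zero_iff.2 hw)) le_rfl
  rw [one_mul] at key
  have : 0 < m * ‖z‖ := mul_pos hm (norm_pos_iff.2 hz0)
  by_contra hc
  have := mul_nonpos_of_nonneg_of_nonpos (norm_nonneg (h z)) (not_lt.1 hc)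
  linarith

/-- Path lifting with control of the modulus: if `|f'(z)| ≥ T'(|z|)` then every value `w` with
`|w| < T(ρ)` is attained in `|z| ≤ ρ`, at a point with `T(|z|) ≤ |w|` (up to a factor `k < 1`). -/
theorem exists_preimage_of_norm_lt {f : ℂ → ℂ} (hf : DifferentiableOn ℂ f (ball 0 1))
    (f0 : f 0 = 0) {T T' : ℝ → ℝ} (T0 : T 0 = 0)
    (hT : ∀ s ∈ Ico (0 : ℝ) 1, HasDerivAt T (T' s) s) (hpos : ∀ s ∈ Ico (0 : ℝ) 1, 0 < T' s)
    (hb : ∀ z ∈ ball (0 : ℂ) 1, T' ‖z‖ ≤ ‖deriv f z‖) {k : ℝ} (hk0 : 0 < k) (hk1 : k < 1)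
    {ρ : ℝ} (hρ0 : 0 ≤ ρ) (hρ : ρ < 1) {w : ℂ} (hw : ‖w‖ < k * T ρ) :
    ∃ z, ‖z‖ ≤ ρ ∧ f z = w ∧ k * T ‖z‖ ≤ ‖w‖ := by
  rcases eq_or_ne w 0 with rfl | hw0
  · exact ⟨0, by simpa, f0, by simp [T0]⟩
  have hwp : 0 < ‖w‖ := norm_pos_iff.2 hw0
  have hsub : closedBall (0 : ℂ) ρ ⊆ ball 0 1 := closedBall_subset_ball hρ
  have hTc : ContinuousOn T (Ico 0 1) := fun s hs => (hT s hs).continuousAt.continuousWithinAt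
  have hmono : StrictMonoOn T (Ico 0 1) := by
    refine strictMonoOn_of_deriv_pos (convex_Ico 0 1) hTc fun s hs => ?_
    rw [interior_Ico] at hs
    rw [(hT s ⟨hs.1.le, hs.2⟩).deriv]
    exact hpos s ⟨hs.1.le, hs.2⟩
  -- Continuity method on the segment from 0 to w: S is closed by compactness, and a local inverse
  -- of f extends it to the right.
  set S : Set ℝ := {t | ∃ z, ‖z‖ ≤ ρ ∧ f z = t * w ∧ k * T ‖z‖ ≤ t * ‖w‖} with hS
  have hclosed : IsClosed (S ∩ Icc 0 1) := by
    have hK : IsClosed ((Icc (0 : ℝ) 1 ×ˢ closedBall (0 : ℂ) ρ) ∩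
        (fun q : ℝ × ℂ => (f q.2 - q.1 * w, q.1 * ‖w‖ - k * T ‖q.2‖)) ⁻¹' ({0} ×ˢ Ici 0)) := by
      refine ContinuousOn.preimage_isClosed_of_isClosed ?_ (isClosed_Icc.prod isClosed_closedBall)
        (isClosed_singleton.prod isClosed_Ici)
      have hm : MapsTo (fun q : ℝ × ℂ => q.2) (Icc (0 : ℝ) 1 ×ˢ closedBall (0 : ℂ) ρ)
        (closedBall 0 ρ) := fun q hq => hq.2
      refine ContinuousOn.prodMk (ContinuousOn.sub ((hf.continuousOn.mono hsub).comp
        continuous_snd.continuousOn hm) (by fun_prop)) (ContinuousOn.sub (by fun_prop) ?_)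
      refine continuousOn_const.mul (hTc.comp (by fun_prop) fun q hq => ?_)
      exact ⟨norm_nonneg _, mem_ball_zero_iff.1 (hsub (hm hq))⟩
    have hcomp := ((isCompact_Icc.prod (isCompact_closedBall (0 : ℂ) ρ)).of_isClosed_subset hK
      inter_subset_left).image continuous_fst
    convert hcomp.isClosed using 1
    ext t
    constructor
    · rintro ⟨⟨z, h1, h2, h3⟩, ht⟩
      refine ⟨(t, z), ⟨⟨ht, by simpa using h1⟩, ?_⟩, rfl⟩
      simp [h2, h3]
    · rintro ⟨⟨t, z⟩, ⟨⟨ht, hz⟩, h⟩, rfl⟩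
      simp only [mem_preimage, mem_prod, mem_singleton_iff, mem_Ici, sub_eq_zero, sub_nonneg] at h
      exact ⟨⟨z, by simpa using hz, h.1, h.2⟩, ht⟩
  have hsubset : Icc (0 : ℝ) 1 ⊆ S := by
    refine hclosed.Icc_subset_of_forall_exists_gt ⟨0, by simpa, by simp [f0], by simp [T0]⟩ ?_
    rintro t ⟨⟨z, hz1, hz2, hz3⟩, ht⟩ y (hy : t < y)
    have hz : z ∈ ball (0 : ℂ) 1 := hsub (by simpa using hz1)
    have hzI : ‖z‖ ∈ Ico (0 : ℝ) 1 := ⟨norm_nonneg _, by simpa using hz⟩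
    have hlt : ‖z‖ < ρ := by
      rw [← hmono.lt_iff_lt hzI ⟨hρ0, hρ⟩]
      have : t * ‖w‖ ≤ 1 * ‖w‖ := by gcongr; exact ht.2.le
      rw [← mul_lt_mul_iff_right₀ hk0]
      linarith
    have hd0 : 0 < ‖deriv f z‖ := (hpos _ hzI).trans_le (hb z hz)
    have hstrict : HasStrictDerivAt f (deriv f z) z :=
      (hf.analyticAt (isOpen_ball.mem_nhds hz)).hasStrictDerivAt
    have hdne : deriv f z ≠ 0 := norm_pos_iff.1 hd0
    set g := hstrict.localInverse f (deriv f z) z hdne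
    have hg : HasDerivAt g (deriv f z)⁻¹ (f z) := (hstrict.to_localInverse hdne).hasDerivAt
    have hgz : g (f z) = z := (hstrict.eventually_left_inverse hdne).self_of_nhds
    have hline : HasDerivAt (fun s : ℝ => f z + s * w) w 0 := by
      simpa using ((hasDerivAt_id (0 : ℝ)).ofReal_comp.mul_const w).const_add (f z)
    have hζ : HasDerivAt (fun s : ℝ => g (f z + s * w)) ((deriv f z)⁻¹ * w) 0 := by
      have h1 : HasDerivAt g (deriv f z)⁻¹ ((fun s : ℝ => f z + s * w) 0) := by simpa using hg
      exact h1.comp 0 hline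
    have hinv : ∀ᶠ s : ℝ in 𝓝 0, f (g (f z + s * w)) = f z + s * w := by
      have h1 : Tendsto (fun s : ℝ => f z + s * w) (𝓝 0) (𝓝 (f z)) := by
        simpa using hline.continuousAt.tendsto
      exact h1.eventually (hstrict.eventually_right_inverse hdne)
    -- The modulus of the lifted point need not be differentiable in s when z = 0. The triangle
    -- inequality majorant used here has right derivative |w|/|f'(z)| at s = 0.
    have hnorm : HasDerivWithinAt (fun s : ℝ => ‖z‖ + ‖g (f z + s * w) - z‖)
        (‖w‖ / ‖deriv f z‖) (Ioi 0) 0 := by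
      refine HasDerivWithinAt.const_add _ ?_
      rw [hasDerivWithinAt_iff_tendsto_slope' (by simp)]
      have h1 := ((hasDerivAt_iff_tendsto_slope.1 hζ).mono_left
        (nhdsWithin_mono 0 (fun s (hs : 0 < s) => hs.ne') : 𝓝[>] (0 : ℝ) ≤ 𝓝[≠] 0)).norm
      rw [norm_mul, norm_inv, ← div_eq_inv_mul] at h1
      refine h1.congr' ?_
      filter_upwards [self_mem_nhdsWithin] with s (hs : 0 < s)
      simp [slope, hgz, abs_of_pos hs]
    have hcomp : HasDerivWithinAt (fun s : ℝ => k * T (‖z‖ + ‖g (f z + s * w) - z‖) - s * ‖w‖)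
        (k * (T' ‖z‖ * (‖w‖ / ‖deriv f z‖)) - 1 * ‖w‖) (Ioi 0) 0 := by
      have h1 : HasDerivAt T (T' ‖z‖) ((fun s : ℝ => ‖z‖ + ‖g (f z + s * w) - z‖) 0) := by
        simpa [hgz] using hT _ hzI
      exact ((h1.comp_hasDerivWithinAt 0 hnorm).const_mul k).sub
        ((hasDerivWithinAt_id 0 _).mul_const ‖w‖)
    -- The factor k < 1 gives strict inequality, so the modulus estimate survives for small s > 0.
    have hneg : k * (T' ‖z‖ * (‖w‖ / ‖deriv f z‖)) - 1 * ‖w‖ < 0 := by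
      have h1 : T' ‖z‖ * (‖w‖ / ‖deriv f z‖) ≤ ‖w‖ := by
        rw [mul_div_assoc', div_le_iff₀ hd0, mul_comm]
        gcongr
        exact hb z hz
      have := hpos _ hzI
      nlinarith
    have e1 := eventually_lt_of_hasDerivWithinAt_neg hcomp hneg
    have hcz : ContinuousAt (fun s : ℝ => ‖z‖ + ‖g (f z + s * w) - z‖) 0 :=
      continuousAt_const.add (hζ.continuousAt.sub continuousAt_const).norm
    have e2 : ∀ᶠ s : ℝ in 𝓝 0, ‖z‖ + ‖g (f z + s * w) - z‖ < ρ :=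
      hcz.eventually_lt continuousAt_const (by simpa [hgz] using hlt)
    have e3 : ∀ᶠ s in 𝓝[>] (0 : ℝ), s ≤ min y 1 - t := by
      have : 0 < min y 1 - t := sub_pos.2 (lt_min hy ht.2)
      filter_upwards [Ioc_mem_nhdsGT this] with s hs using hs.2
    obtain ⟨s, ⟨⟨⟨h1, h2⟩, h3⟩, h4⟩, h5⟩ := (((e1.and
      (e2.filter_mono nhdsWithin_le_nhds)).and (hinv.filter_mono nhdsWithin_le_nhds)).and
      e3 |>.and self_mem_nhdsWithin).exists
    have hs0 : 0 < s := h5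
    simp only [Complex.ofReal_zero, zero_mul, add_zero, hgz, sub_self, norm_zero, sub_zero] at h1
    have hle : ‖g (f z + s * w)‖ ≤ ‖z‖ + ‖g (f z + s * w) - z‖ := by
      have := norm_add_le z (g (f z + s * w) - z)
      simpa using this
    refine ⟨t + s, ⟨g (f z + s * w), hle.trans h2.le, ?_, ?_⟩, by linarith, ?_⟩
    · rw [h3, hz2]
      push_cast
      ring
    · have : T ‖g (f z + s * w)‖ ≤ T (‖z‖ + ‖g (f z + s * w) - z‖) :=
        hmono.monotoneOn ⟨norm_nonneg _, (hle.trans h2.le).trans_lt hρ⟩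
          ⟨by positivity, h2.trans hρ⟩ hle
      nlinarith
    · have := min_le_left y 1
      linarith
  obtain ⟨z, h1, h2, h3⟩ := hsubset (right_mem_Icc.2 zero_le_one)
  exact ⟨z, h1, by simpa using h2, by simpa using h3⟩

/-- Growth of an injective function whose derivative is bounded below. -/
theorem le_norm_of_injOn {f : ℂ → ℂ} (hf : DifferentiableOn ℂ f (ball 0 1))
    (f0 : f 0 = 0) (hi : InjOn f (ball 0 1)) {T T' : ℝ → ℝ} (T0 : T 0 = 0)
    (hT : ∀ s ∈ Ico (0 : ℝ) 1, HasDerivAt T (T' s) s) (hpos : ∀ s ∈ Ico (0 : ℝ) 1, 0 < T' s)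
    (hb : ∀ z ∈ ball (0 : ℂ) 1, T' ‖z‖ ≤ ‖deriv f z‖) {z : ℂ} (hz : z ∈ ball (0 : ℂ) 1) :
    T ‖z‖ ≤ ‖f z‖ := by
  by_contra hlt
  have hlt := not_le.1 hlt
  have hz1 : ‖z‖ < 1 := mem_ball_zero_iff.1 hz
  have hTp : 0 < T ‖z‖ := (norm_nonneg _).trans_lt hlt
  obtain ⟨k, hk1, hk2⟩ := exists_between ((div_lt_one hTp).2 hlt)
  have hk0 : 0 < k := lt_of_le_of_lt (by positivity) hk1
  have hw : ‖f z‖ < k * T ‖z‖ := by rwa [div_lt_iff₀ hTp] at hk1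
  -- By univalence the lifted preimage is z itself, so k T(|z|) ≤ |f(z)|, against the choice of k.
  obtain ⟨y, hy1, hy2, hy3⟩ := exists_preimage_of_norm_lt hf f0 T0 hT hpos hb hk0 hk2
    (norm_nonneg z) hz1 hw
  have : y = z := hi (mem_ball_zero_iff.2 (hy1.trans_lt hz1)) hz hy2
  rw [this] at hy3
  linarith

/-! ### Convex univalent functions -/

namespace IsConvexMap

variable {g : ℂ → ℂ}

theorem deriv_ne_zero (hg : IsConvexMap g) {z : ℂ} (hz : z ∈ ball (0 : ℂ) 1) : deriv g z ≠ 0 :=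
  (exists_holomorphic_inverse hg.analytic hg.univalent).2.1 z hz

theorem hasDerivAt (hg : IsConvexMap g) {z : ℂ} (hz : z ∈ ball (0 : ℂ) 1) :
    HasDerivAt g (deriv g z) z :=
  (hg.analytic.differentiableAt (isOpen_ball.mem_nhds hz)).hasDerivAt

theorem mul_mem_ball {b z : ℂ} (hb : ‖b‖ ≤ 1) (hz : z ∈ ball (0 : ℂ) 1) :
    b * z ∈ ball (0 : ℂ) 1 := by
  rw [mem_ball_zero_iff] at hz ⊢
  rw [norm_mul]
  exact (mul_le_of_le_one_left (norm_nonneg z) hb).trans_lt hz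

/-- The supporting half-plane inequality for convex functions. -/
theorem re_sub_div_nonneg (hg : IsConvexMap g) {z b : ℂ} (hz : z ∈ ball (0 : ℂ) 1) (hb : ‖b‖ ≤ 1) :
    0 ≤ ((g z - g (b * z)) / (z * deriv g z)).re := by
  obtain ⟨ho, -, ψ, hψ, hl⟩ := exists_holomorphic_inverse hg.analytic hg.univalent
  rcases eq_or_ne z 0 with rfl | hz0
  · simp
  have hgz := hg.deriv_ne_zero hz
  have hmem : ∀ ε ∈ Icc (0 : ℝ) 1, ∀ y ∈ ball (0 : ℂ) 1,
      g y + ε * (g (b * y) - g y) ∈ g '' ball 0 1 := by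
    intro ε hε y hy
    have := hg.convex_image (mem_image_of_mem g hy) (mem_image_of_mem g (mul_mem_ball hb hy))
      (sub_nonneg.2 hε.2) hε.1 (by ring)
    convert this using 1
    simp only [Complex.real_smul]
    push_cast
    ring
  have hself : ∀ w ∈ g '' ball 0 1, ψ w ∈ ball (0 : ℂ) 1 := by
    rintro _ ⟨y, hy, rfl⟩
    rwa [hl y hy]
  -- By convexity the point at proportion ε from g(y) to g(by) is again a value of g. Pulled back by
  -- `ψ` it defines a self-map of the disc fixing 0, so Schwarz's lemma applies; its derivative at ε
  -- = 0 gives the half-plane inequality.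
  have hschwarz : ∀ ε ∈ Icc (0 : ℝ) 1, ‖ψ (g z + ε * (g (b * z) - g z))‖ ≤ ‖z‖ := by
    intro ε hε
    refine Complex.norm_le_norm_of_mapsTo_ball (R := 1)
      (f := fun y => ψ (g y + ε * (g (b * y) - g y))) ?_ ?_ ?_ (mem_ball_zero_iff.1 hz)
    · refine hψ.comp ?_ fun y hy => hmem ε hε y hy
      have : DifferentiableOn ℂ (fun y => g (b * y)) (ball 0 1) :=
        hg.analytic.comp (by fun_prop) fun y hy => mul_mem_ball hb hy
      exact hg.analytic.add ((this.sub hg.analytic).const_mul _)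
    · exact fun y hy => ball_subset_closedBall (hself _ (hmem ε hε y hy))
    · simp only [mul_zero, hg.map_zero, sub_zero, add_zero]
      have := hl 0 (by simp)
      rwa [hg.map_zero] at this
  have hψd : HasDerivAt ψ (deriv g z)⁻¹ (g z) := by
    have h1 : DifferentiableAt ℂ ψ (g z) :=
      hψ.differentiableAt (ho.mem_nhds (mem_image_of_mem g hz))
    have h2 := h1.hasDerivAt.comp z (hg.hasDerivAt hz)
    have h3 : HasDerivAt (ψ ∘ g) 1 z := by
      refine (hasDerivAt_id z).congr_of_eventuallyEq ?_
      filter_upwards [isOpen_ball.mem_nhds hz] with y hy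
      simp [hl y hy]
    have h4 := h2.unique h3
    rw [← eq_inv_of_mul_eq_one_left h4]
    exact h1.hasDerivAt
  set φ : ℝ → ℝ := fun ε => -(starRingEnd ℂ z * ψ (g z + ε * (g (b * z) - g z))).re with hφ
  have hφd : HasDerivAt φ (-(starRingEnd ℂ z * ((deriv g z)⁻¹ * (g (b * z) - g z))).re) 0 := by
    have h1 : HasDerivAt (fun ε : ℝ => g z + ε * (g (b * z) - g z)) (g (b * z) - g z) 0 := by
      simpa using ((hasDerivAt_id (0 : ℝ)).ofReal_comp.mul_const (g (b * z) - g z)).const_add (g z)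
    have h2 : HasDerivAt ψ (deriv g z)⁻¹ ((fun ε : ℝ => g z + ε * (g (b * z) - g z)) 0) := by
      simpa using hψd
    have h3 := (h2.comp 0 h1).const_mul (starRingEnd ℂ z)
    exact (Complex.reCLM.hasFDerivAt.comp_hasDerivAt 0 h3).neg
  have hge : 0 ≤ -(starRingEnd ℂ z * ((deriv g z)⁻¹ * (g (b * z) - g z))).re := by
    by_contra hneg
    obtain ⟨ε, h1, h2⟩ := ((eventually_lt_of_hasDerivWithinAt_neg hφd.hasDerivWithinAt
      (not_le.1 hneg)).and (Ioc_mem_nhdsGT one_pos)).exists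
    have h3 := hschwarz ε ⟨h2.1.le, h2.2⟩
    have h4 : φ 0 = -‖z‖ ^ 2 := by
      simp only [hφ, Complex.ofReal_zero, zero_mul, add_zero, hl z hz]
      rw [mul_comm, Complex.mul_conj, Complex.normSq_eq_norm_sq, Complex.ofReal_re]
    have h5 : (starRingEnd ℂ z * ψ (g z + ε * (g (b * z) - g z))).re ≤ ‖z‖ * ‖z‖ := by
      refine (Complex.re_le_norm _).trans ?_
      rw [norm_mul, Complex.norm_conj]
      gcongr
    rw [h4] at h1
    simp only [hφ] at h1
    nlinarith
  have e : (g z - g (b * z)) / (z * deriv g z) = ((‖z‖ ^ 2)⁻¹ : ℝ) *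
      -(starRingEnd ℂ z * ((deriv g z)⁻¹ * (g (b * z) - g z))) := by
    have h1 : z * starRingEnd ℂ z = ((‖z‖ ^ 2 : ℝ) : ℂ) := by
      rw [Complex.mul_conj, Complex.normSq_eq_norm_sq]
    have h2 : starRingEnd ℂ z ≠ 0 := (map_ne_zero _).2 hz0
    rw [Complex.ofReal_inv, ← h1]
    field_simp
    ring
  rw [e, Complex.re_ofReal_mul, Complex.neg_re]
  exact mul_nonneg (by positivity) hge

theorem hasDerivAt_eulerOp (hg : IsConvexMap g) {z : ℂ} (hz : z ∈ ball (0 : ℂ) 1) :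
    HasDerivAt (eulerOp g) (deriv g z + z * deriv (deriv g) z) z := by
  have h1 : HasDerivAt (deriv g) (deriv (deriv g) z) z :=
    ((differentiableOn_deriv hg.analytic).differentiableAt (isOpen_ball.mem_nhds hz)).hasDerivAt
  have e : deriv g z + z * deriv (deriv g) z = 1 * deriv g z + id z * deriv (deriv g) z := by simp
  rw [e]
  exact (hasDerivAt_id z).mul h1

/-- The analytic characterization of convexity: `Re (1 + z g'' / g') ≥ 0`. -/
theorem re_deriv_eulerOp_div_nonneg (hg : IsConvexMap g) {z : ℂ} (hz : z ∈ ball (0 : ℂ) 1) :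
    0 ≤ (deriv (eulerOp g) z / deriv g z).re := by
  rcases eq_or_ne z 0 with rfl | hz0
  · rw [(hg.hasDerivAt_eulerOp hz).deriv]
    simp [hg.deriv_ne_zero hz]
  have hgz := hg.deriv_ne_zero hz
  set ζ : ℝ → ℂ := fun θ => Complex.exp (θ * Complex.I) * z with hζ
  have hζb : ∀ θ, ζ θ ∈ ball (0 : ℂ) 1 := fun θ =>
    mul_mem_ball (Complex.norm_exp_ofReal_mul_I θ).le hz
  have hζ0 : ζ 0 = z := by simp [hζ]
  have hζd : ∀ θ, HasDerivAt ζ (Complex.I * ζ θ) θ := by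
    intro θ
    have h1 := (((hasDerivAt_id θ).ofReal_comp.mul_const Complex.I).cexp).mul_const z
    have e : Complex.I * ζ θ
        = Complex.exp ((id θ : ℝ) * Complex.I) * ((1 : ℝ) * Complex.I) * z := by
      simp only [hζ, id, Complex.ofReal_one, one_mul]; ring
    rw [e]
    exact h1
  -- Taking b = exp(iθ) in the half-plane inequality makes θ = 0 a minimum of φ, with value 0. The
  -- second derivative there is Re((zg')'/g').
  set φ : ℝ → ℝ := fun θ => ((g z - g (ζ θ)) / (z * deriv g z)).re with hφ
  have hφnn : ∀ θ, 0 ≤ φ θ := fun θ =>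
    hg.re_sub_div_nonneg hz (Complex.norm_exp_ofReal_mul_I θ).le
  have hφ0 : φ 0 = 0 := by simp [hφ, hζ0]
  have hφd : ∀ θ, HasDerivAt φ (-(Complex.I * eulerOp g (ζ θ)) / (z * deriv g z)).re θ := by
    intro θ
    have h1 := (((hg.hasDerivAt (hζb θ)).comp θ (hζd θ)).const_sub (g z)).div_const (z * deriv g z)
    have e : -(Complex.I * eulerOp g (ζ θ)) / (z * deriv g z)
      = -(deriv g (ζ θ) * (Complex.I * ζ θ)) / (z * deriv g z) := by
      simp only [eulerOp]; ring
    rw [e]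
    exact Complex.reCLM.hasFDerivAt.comp_hasDerivAt θ h1
  have hφd' : deriv φ = fun θ => (-(Complex.I * eulerOp g (ζ θ)) / (z * deriv g z)).re :=
    funext fun θ => (hφd θ).deriv
  have hφdd : HasDerivAt (deriv φ) (deriv (eulerOp g) z / deriv g z).re 0 := by
    rw [hφd']
    have h1 : HasDerivAt (eulerOp g) (deriv (eulerOp g) z) (ζ 0) := by
      rw [hζ0, (hg.hasDerivAt_eulerOp hz).deriv]
      exact hg.hasDerivAt_eulerOp hz
    have h2 := (((h1.comp 0 (hζd 0)).const_mul Complex.I).neg).div_const (z * deriv g z)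
    have e : deriv (eulerOp g) z / deriv g z
      = -(Complex.I * (deriv (eulerOp g) z * (Complex.I * ζ 0))) / (z * deriv g z) := by
      rw [hζ0]
      field_simp
      rw [Complex.I_sq]
      ring
    rw [e]
    exact Complex.reCLM.hasFDerivAt.comp_hasDerivAt 0 h2
  by_contra hneg
  rw [← hφdd.deriv] at hneg
  -- A negative second derivative would make θ = 0 a local maximum as well, so φ would be locally
  -- constant and its second derivative 0.
  have hmax := isLocalMax_of_deriv_deriv_neg (not_le.1 hneg) (by
    rw [hφd']
    simp only [hζ0, eulerOp]
    have : -(Complex.I * (z * deriv g z)) / (z * deriv g z) = -Complex.I := by field_simp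
    rw [this]; simp) (hφd 0).continuousAt
  have hz : φ =ᶠ[𝓝 0] fun _ => 0 := by
    filter_upwards [hmax] with θ hθ
    rw [hφ0] at hθ
    exact le_antisymm hθ (hφnn θ)
  rw [hz.deriv.deriv_eq] at hneg
  simp at hneg

/-- The quotient is 1 at the origin, so Schwarz's lemma turns its nonnegative real part into a
quantitative bound, and in particular into strict positivity. -/
theorem norm_deriv_eulerOp_div_sub_one_le (hg : IsConvexMap g) {z : ℂ} (hz : z ∈ ball (0 : ℂ) 1) :
    ‖deriv (eulerOp g) z / deriv g z - 1‖ ≤ ‖z‖ * ‖deriv (eulerOp g) z / deriv g z + 1‖ := by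
  refine norm_sub_one_le_of_re_nonneg (P := fun z => deriv (eulerOp g) z / deriv g z)
    ((differentiableOn_deriv (differentiableOn_eulerOp hg.analytic)).div
      (differentiableOn_deriv hg.analytic) fun z hz => hg.deriv_ne_zero hz) ?_
    (fun z hz => hg.re_deriv_eulerOp_div_nonneg hz) hz
  have h0 : (0 : ℂ) ∈ ball (0 : ℂ) 1 := by simp
  rw [(hg.hasDerivAt_eulerOp h0).deriv]
  simp [hg.deriv_ne_zero h0]

theorem le_re_deriv_eulerOp_div (hg : IsConvexMap g) {z : ℂ} (hz : z ∈ ball (0 : ℂ) 1) :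
    (1 - ‖z‖) / (1 + ‖z‖) ≤ (deriv (eulerOp g) z / deriv g z).re :=
  le_re_of_norm_sub_one_le (norm_nonneg z) (mem_ball_zero_iff.1 hz)
    (hg.norm_deriv_eulerOp_div_sub_one_le hz)

/-- Alexander's theorem: for h = zg' the quotient zh'/h is (zg')'/g', so convexity of g is
starlikeness of h. -/
theorem eulerOp_starlike (hg : IsConvexMap g) {z : ℂ} (hz : z ∈ ball (0 : ℂ) 1) (hz0 : z ≠ 0) :
    0 < (z * deriv (eulerOp g) z / eulerOp g z).re := by
  have e : z * deriv (eulerOp g) z / eulerOp g z = deriv (eulerOp g) z / deriv g z := by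
    rw [eulerOp]; exact mul_div_mul_left _ _ hz0
  rw [e]
  refine lt_of_lt_of_le ?_ (hg.le_re_deriv_eulerOp_div hz)
  have : ‖z‖ < 1 := mem_ball_zero_iff.1 hz
  have := norm_nonneg z
  apply div_pos <;> linarith

/-- The distortion theorem for convex functions (lower bound). -/
theorem le_norm_deriv (hg : IsConvexMap g) {z : ℂ} (hz : z ∈ ball (0 : ℂ) 1) :
    ‖deriv g 0‖ / (1 + ‖z‖) ^ 2 ≤ ‖deriv g z‖ := by
  have hz1 : ‖z‖ < 1 := mem_ball_zero_iff.1 hz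
  have hmem : ∀ t ∈ Icc (0 : ℝ) 1, (t : ℂ) * z ∈ ball (0 : ℂ) 1 := fun t ht =>
    mul_mem_ball (by rw [Complex.norm_real, Real.norm_of_nonneg ht.1]; exact ht.2) hz
  -- The derivative of φ is a positive multiple of q(1 + t|z|) + 2|z|, where q = Re(z
  -- g''(tz)/g'(tz)). This is nonnegative because 1 + tq ≥ (1 − t|z|)/(1 + t|z|).
  set φ : ℝ → ℝ := fun t => ‖deriv g (t * z)‖ * (1 + t * ‖z‖) ^ 2 with hφ
  have hd : ∀ t ∈ Icc (0 : ℝ) 1, HasDerivAt φ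
      ((starRingEnd ℂ (deriv g (t * z)) * (deriv (deriv g) (t * z) * z)).re / ‖deriv g (t * z)‖
        * (1 + t * ‖z‖) ^ 2 + ‖deriv g (t * z)‖ * (2 * (1 + t * ‖z‖) * ‖z‖)) t := by
    intro t ht
    have h1 : HasDerivAt (deriv g) (deriv (deriv g) (t * z)) (t * z) :=
      ((differentiableOn_deriv hg.analytic).differentiableAt
        (isOpen_ball.mem_nhds (hmem t ht))).hasDerivAt
    have h2 : HasDerivAt (fun t : ℝ => (t : ℂ) * z) z t := by
      simpa using (hasDerivAt_id t).ofReal_comp.mul_const z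
    have h1' : HasDerivAt (deriv g) (deriv (deriv g) (t * z)) ((fun t : ℝ => (t : ℂ) * z) t) := h1
    have h12 : HasDerivAt (fun t : ℝ => deriv g ((t : ℂ) * z)) (deriv (deriv g) (t * z) * z) t :=
      HasDerivAt.comp (h₂ := deriv g) t h1' h2
    have h3 := hasDerivAt_norm_curve h12 (hg.deriv_ne_zero (hmem t ht))
    have h4 : HasDerivAt (fun t : ℝ => (1 + t * ‖z‖) ^ 2) (2 * (1 + t * ‖z‖) * ‖z‖) t := by
      simpa using (((hasDerivAt_id t).mul_const ‖z‖).const_add 1).fun_pow 2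
    exact h3.mul h4
  have hmono : MonotoneOn φ (Icc 0 1) := by
    refine monotoneOn_of_deriv_nonneg (convex_Icc 0 1)
      (fun t ht => (hd t ht).continuousAt.continuousWithinAt)
      (fun t ht => (hd t (interior_subset ht)).differentiableAt.differentiableWithinAt) ?_
    intro t ht
    rw [interior_Icc] at ht
    have htI : t ∈ Icc (0 : ℝ) 1 := ⟨ht.1.le, ht.2.le⟩
    rw [(hd t htI).deriv]
    have hne := hg.deriv_ne_zero (hmem t htI)
    have hnp : 0 < ‖deriv g (t * z)‖ := norm_pos_iff.2 hne
    have h1 := hg.le_re_deriv_eulerOp_div (hmem t htI)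
    rw [(hg.hasDerivAt_eulerOp (hmem t htI)).deriv, norm_mul, Complex.norm_real,
      Real.norm_of_nonneg ht.1.le] at h1
    have e1 : (deriv g (t * z) + t * z * deriv (deriv g) (t * z)) / deriv g (t * z)
        = 1 + (t : ℝ) * (deriv (deriv g) (t * z) * z / deriv g (t * z)) := by
      field_simp
    have e2 : (starRingEnd ℂ (deriv g (t * z)) * (deriv (deriv g) (t * z) * z)).re
        = ‖deriv g (t * z)‖ ^ 2 * (deriv (deriv g) (t * z) * z / deriv g (t * z)).re := by
      rw [← Complex.re_ofReal_mul, ← Complex.normSq_eq_norm_sq, ← Complex.mul_conj]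
      congr 1
      field_simp
    rw [e1, Complex.add_re, Complex.re_ofReal_mul, Complex.one_re] at h1
    rw [e2]
    set q := (deriv (deriv g) (t * z) * z / deriv g (t * z)).re
    have hp : 0 < 1 + t * ‖z‖ := by have := mul_nonneg ht.1.le (norm_nonneg z); linarith
    rw [div_le_iff₀ hp] at h1
    have h2 : 0 ≤ q * (1 + t * ‖z‖) + 2 * ‖z‖ := by
      have : 0 ≤ t * (q * (1 + t * ‖z‖) + 2 * ‖z‖) := by nlinarith
      exact nonneg_of_mul_nonneg_right this ht.1
    have e3 : ‖deriv g (t * z)‖ ^ 2 * q / ‖deriv g (t * z)‖ * (1 + t * ‖z‖) ^ 2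
        + ‖deriv g (t * z)‖ * (2 * (1 + t * ‖z‖) * ‖z‖)
        = ‖deriv g (t * z)‖ * (1 + t * ‖z‖) * (q * (1 + t * ‖z‖) + 2 * ‖z‖) := by
      field_simp
    rw [e3]
    positivity
  have h01 := hmono (left_mem_Icc.2 zero_le_one) (right_mem_Icc.2 zero_le_one) zero_le_one
  simp only [hφ, Complex.ofReal_zero, zero_mul, Complex.ofReal_one, one_mul, add_zero, one_pow,
    mul_one] at h01
  rw [div_le_iff₀ (by positivity)]
  exact h01

theorem le_norm_deriv_eulerOp (hg : IsConvexMap g) {z : ℂ} (hz : z ∈ ball (0 : ℂ) 1) :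
    ‖deriv g 0‖ * ((1 - ‖z‖) / (1 + ‖z‖) ^ 3) ≤ ‖deriv (eulerOp g) z‖ := by
  have h1 := hg.le_norm_deriv hz
  have h2 := (hg.le_re_deriv_eulerOp_div hz).trans (Complex.re_le_norm _)
  have hz1 : ‖z‖ < 1 := mem_ball_zero_iff.1 hz
  have hne := norm_pos_iff.2 (hg.deriv_ne_zero hz)
  rw [norm_div, le_div_iff₀ hne] at h2
  refine le_trans ?_ h2
  have h3 : 0 ≤ (1 - ‖z‖) / (1 + ‖z‖) := by
    have := norm_nonneg z
    apply div_nonneg <;> linarith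
  calc _ = (1 - ‖z‖) / (1 + ‖z‖) * (‖deriv g 0‖ / (1 + ‖z‖) ^ 2) := by
        have : 1 + ‖z‖ ≠ 0 := by positivity
        field_simp
    _ ≤ _ := by gcongr

/-- Loewner's bound for the coefficients of a convex function. -/
theorem norm_taylorCoeff_le (hg : IsConvexMap g) (n : ℕ) : ‖taylorCoeff g n‖ ≤ ‖deriv g 0‖ := by
  set P : ℂ → ℂ := fun z => deriv (eulerOp g) z / deriv g z with hP
  have hPd : DifferentiableOn ℂ P (ball 0 1) :=
    (differentiableOn_deriv (differentiableOn_eulerOp hg.analytic)).div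
      (differentiableOn_deriv hg.analytic) fun z hz => hg.deriv_ne_zero hz
  have h0 : (0 : ℂ) ∈ ball (0 : ℂ) 1 := by simp
  have hP0 : P 0 = 1 := by
    simp only [hP]
    rw [(hg.hasDerivAt_eulerOp h0).deriv]
    simp [hg.deriv_ne_zero h0]
  have hPc : ∀ i ≠ 0, ‖taylorCoeff P i‖ ≤ 2 := fun i hi => by
    simpa [hP0] using norm_taylorCoeff_le_of_re_nonneg hPd
      (fun z hz => hg.re_deriv_eulerOp_div_nonneg hz) hi
  -- Coefficients of (zg')' = P g'. Moving the term i = 0 to the left leaves n(n + 1) times the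
  -- coefficient of index n + 1, expressed by earlier ones. As |P_i| ≤ 2 and 2 + 4 + ⋯ + 2n = n(n +
  -- 1), the induction closes.
  have hrec : ∀ n : ℕ, ((n : ℂ) + 1) * (n + 1) * taylorCoeff g (n + 1) = ∑ i ∈ Finset.range (n + 1),
      taylorCoeff P i * (((n - i : ℕ) + 1) * taylorCoeff g (n - i + 1)) := by
    intro n
    have h1 := taylorCoeff_deriv (eulerOp g) n
    rw [taylorCoeff_eulerOp hg.analytic] at h1
    have h2 : EqOn (deriv (eulerOp g)) (fun z => P z * deriv g z) (ball 0 1) := fun z hz =>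
      (div_mul_cancel₀ _ (hg.deriv_ne_zero hz)).symm
    rw [taylorCoeff_congr h2, taylorCoeff_mul hPd (differentiableOn_deriv hg.analytic)] at h1
    simp only [taylorCoeff_deriv] at h1
    rw [h1]
    push_cast
    ring
  induction n using Nat.strong_induction_on with
  | _ n ih =>
    rcases n with _ | _ | n
    · simp [taylorCoeff_zero, hg.map_zero]
    · simp [taylorCoeff_one]
    · have h1 := hrec (n + 1)
      rw [Finset.sum_range_succ', taylorCoeff_zero, hP0] at h1
      have h2 : ((n : ℂ) + 1) * (n + 2) * taylorCoeff g (n + 2)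
          = ∑ i ∈ Finset.range (n + 1),
            taylorCoeff P (i + 1) * (((n - i : ℕ) + 1) * taylorCoeff g (n - i + 1)) := by
        simp only [Nat.add_sub_add_right, Nat.sub_zero] at h1
        push_cast at h1 ⊢
        linear_combination h1
      have h3 := congrArg norm h2
      have e : ‖((n : ℂ) + 1) * (n + 2)‖ = (n + 1) * (n + 2) := by
        rw [norm_mul]
        norm_cast
      rw [norm_mul, e] at h3
      have h4 : ∑ i ∈ Finset.range (n + 1), (2 * (((n - i : ℕ) : ℝ) + 1) * ‖deriv g 0‖)
          = (n + 1) * (n + 2) * ‖deriv g 0‖ := by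
        rw [← Finset.sum_mul]
        congr 1
        have h := Finset.sum_range_reflect (fun j : ℕ => 2 * ((j : ℝ) + 1)) (n + 1)
        simp only [Nat.add_sub_cancel] at h
        rw [h]
        clear * -
        induction n with
        | zero => norm_num
        | succ n ih =>
          rw [Finset.sum_range_succ, ih]
          push_cast
          ring
      have h5 : (n + 1) * (n + 2) * ‖taylorCoeff g (n + 2)‖ ≤ (n + 1) * (n + 2) * ‖deriv g 0‖ := by
        rw [h3, ← h4]
        refine (norm_sum_le _ _).trans (Finset.sum_le_sum fun i hi => ?_)
        rw [norm_mul, norm_mul]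
        have h6 : ‖(((n - i : ℕ) : ℂ) + 1)‖ = ((n - i : ℕ) : ℝ) + 1 := by norm_cast
        rw [h6, ← mul_assoc]
        gcongr
        · exact hPc _ (Nat.succ_ne_zero i)
        · exact ih _ (by omega)
      exact le_of_mul_le_mul_left h5 (by positivity)

/-- Two-point form of the analytic characterization of convexity. -/
theorem re_eulerOp_sub_div_nonneg (hg : IsConvexMap g) {z b : ℂ} (hz : z ∈ ball (0 : ℂ) 1)
    (hb : ‖b‖ ≤ 1) : 0 ≤ ((eulerOp g z - eulerOp g (b * z)) / (g z - g (b * z))).re := by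
  rcases eq_or_ne b 1 with rfl | hb1
  · simp
  rcases eq_or_ne z 0 with rfl | hz0
  · simp
  have hz1 : ‖z‖ < 1 := mem_ball_zero_iff.1 hz
  have hzp : 0 < ‖z‖ := norm_pos_iff.2 hz0
  -- With z fixed, the quotient is holomorphic in b beyond the closed unit disc; the divided
  -- differences `A` and `B` remove the singularity at b = 1.
  set R : ℝ := 1 / ‖z‖ with hR
  have hR1 : 1 < R := by rw [hR, lt_div_iff₀ hzp]; linarith
  have hmaps : MapsTo (fun b : ℂ => b * z) (ball 0 R) (ball 0 1) := by
    intro b hb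
    rw [mem_ball_zero_iff] at hb ⊢
    rwa [norm_mul, ← lt_div_iff₀ hzp]
  have hRn : ball (0 : ℂ) R ∈ 𝓝 (1 : ℂ) := isOpen_ball.mem_nhds (by simpa using hR1)
  have d1 : DifferentiableOn ℂ (fun b => eulerOp g (b * z)) (ball 0 R) :=
    (differentiableOn_eulerOp hg.analytic).comp (by fun_prop) hmaps
  have d2 : DifferentiableOn ℂ (fun b => g (b * z)) (ball 0 R) :=
    hg.analytic.comp (by fun_prop) hmaps
  set A := dslope (fun b => eulerOp g (b * z)) 1 with hA
  set B := dslope (fun b => g (b * z)) 1 with hB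
  have hAd : DifferentiableOn ℂ A (ball 0 R) := (Complex.differentiableOn_dslope hRn).2 d1
  have hBd : DifferentiableOn ℂ B (ball 0 R) := (Complex.differentiableOn_dslope hRn).2 d2
  have hline : HasDerivAt (fun b : ℂ => b * z) z 1 := by
    simpa using (hasDerivAt_id (1 : ℂ)).mul_const z
  have hA1 : A 1 = deriv (eulerOp g) z * z := by
    rw [hA, dslope_same]
    have h1 : HasDerivAt (eulerOp g) (deriv (eulerOp g) z) ((fun b : ℂ => b * z) 1) := by
      rw [(hg.hasDerivAt_eulerOp hz).deriv]
      beta_reduce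
      rw [one_mul]
      exact hg.hasDerivAt_eulerOp hz
    exact (h1.comp 1 hline).deriv
  have hB1 : B 1 = deriv g z * z := by
    rw [hB, dslope_same]
    have h1 : HasDerivAt g (deriv g z) ((fun b : ℂ => b * z) 1) := by
      beta_reduce; rw [one_mul]; exact hg.hasDerivAt hz
    exact (h1.comp 1 hline).deriv
  have hAB : ∀ b ≠ 1, A b / B b = (eulerOp g z - eulerOp g (b * z)) / (g z - g (b * z)) := by
    intro b hb
    rw [hA, hB, dslope_of_ne _ hb, dslope_of_ne _ hb, slope_def_field, slope_def_field, one_mul,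
      div_div_div_cancel_right₀ (sub_ne_zero.2 hb), ← neg_sub, ← neg_sub (g z), neg_div_neg_eq]
  have hBne : ∀ b ∈ ball (0 : ℂ) R, B b ≠ 0 := by
    intro b hb
    rcases eq_or_ne b 1 with rfl | hb1
    · rw [hB1]; exact mul_ne_zero (hg.deriv_ne_zero hz) hz0
    · rw [hB, dslope_of_ne _ hb1, slope_def_field, one_mul]
      refine div_ne_zero (sub_ne_zero.2 fun h => hb1 ?_) (sub_ne_zero.2 hb1)
      have := hg.univalent (hmaps hb) hz h
      exact mul_right_cancel₀ hz0 (by rw [one_mul]; exact this)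
  have hsub : closedBall (0 : ℂ) 1 ⊆ ball 0 R := closedBall_subset_ball hR1
  -- The maximum principle for exp(−A/B) reduces Re(A/B) ≥ 0 to |b| = 1.
  have hFd : DiffContOnCl ℂ (fun b => Complex.exp (-(A b / B b))) (ball 0 1) := by
    refine DifferentiableOn.diffContOnCl ?_
    rw [closure_ball _ one_ne_zero]
    exact ((hAd.div hBd hBne).neg.cexp).mono hsub
  have hfr : ∀ b ∈ frontier (ball (0 : ℂ) 1), ‖Complex.exp (-(A b / B b))‖ ≤ 1 := by
    intro b hb
    rw [frontier_ball _ one_ne_zero, mem_sphere_zero_iff_norm] at hb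
    rw [Complex.norm_exp, Real.exp_le_one_iff, Complex.neg_re, neg_nonpos]
    rcases eq_or_ne b 1 with rfl | hb1
    · rw [hA1, hB1, mul_div_mul_right _ _ hz0]
      exact hg.re_deriv_eulerOp_div_nonneg hz
    · rw [hAB b hb1]
      have hb0 : b ≠ 0 := by rintro rfl; simp at hb
      have hbz := mul_mem_ball hb.le hz
      -- For |b| = 1 the half-plane inequality holds at z and also, with b⁻¹, at bz. The reciprocals
      -- of the two quotients add up to the two-point quotient.
      have h1 := hg.re_sub_div_nonneg hz hb.le
      have h2 := hg.re_sub_div_nonneg hbz (b := b⁻¹) (by rw [norm_inv, hb, inv_one])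
      rw [inv_mul_cancel_left₀ hb0] at h2
      have hinv : ∀ w : ℂ, 0 ≤ w.re → 0 ≤ w⁻¹.re := fun w hw => by
        rw [Complex.inv_re]; exact div_nonneg hw (Complex.normSq_nonneg _)
      have h3 := add_nonneg (hinv _ h1) (hinv _ h2)
      rw [← Complex.add_re, inv_div, inv_div] at h3
      refine h3.trans_eq (congrArg Complex.re ?_)
      simp only [eulerOp]
      rw [← neg_sub (g z) (g (b * z)), div_neg]
      ring
  have key := Complex.norm_le_of_forall_mem_frontier_norm_le isBounded_ball hFd hfr
    (z := b) (by rw [closure_ball _ one_ne_zero]; simpa using hb)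
  rw [Complex.norm_exp, Real.exp_le_one_iff, Complex.neg_re, neg_nonpos, hAB b hb1] at key
  exact key

/-- A function `f` whose Euler derivative has difference quotients with respect to `g` of positive
real part is univalent. -/
theorem injOn_of_re_sub_div_pos (hg : IsConvexMap g) {f : ℂ → ℂ}
    (hf : DifferentiableOn ℂ f (ball 0 1)) (hf0 : 0 < (deriv f 0 / deriv g 0).re)
    (hF : ∀ z ∈ ball (0 : ℂ) 1, ∀ w ∈ ball (0 : ℂ) 1, z ≠ w →
      0 < ((eulerOp f z - eulerOp f w) / (g z - g w)).re) : InjOn f (ball 0 1) := by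
  -- Of two points with the same value, the one of smaller modulus is bz with |b| ≤ 1.
  suffices H : ∀ z ∈ ball (0 : ℂ) 1, ∀ b : ℂ, ‖b‖ ≤ 1 → b ≠ 1 → z ≠ 0 → f z ≠ f (b * z) by
    have H' : ∀ z ∈ ball (0 : ℂ) 1, ∀ w ∈ ball (0 : ℂ) 1, ‖w‖ ≤ ‖z‖ → f z = f w → z = w := by
      intro z hz w hw hle h
      by_contra hne
      have hz0 : z ≠ 0 := by
        rintro rfl
        exact hne (norm_le_zero_iff.1 (by simpa using hle)).symm
      refine H z hz (w / z) ?_ ?_ hz0 ?_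
      · rw [norm_div]; exact div_le_one_of_le₀ hle (norm_nonneg z)
      · intro h1
        rw [div_eq_one_iff_eq hz0] at h1
        exact hne h1.symm
      · rwa [div_mul_cancel₀ _ hz0]
    intro z hz w hw h
    rcases le_total ‖w‖ ‖z‖ with hle | hle
    · exact H' z hz w hw hle h
    · exact (H' w hw z hz hle h.symm).symm
  intro z₀ hz₀ b hb hb1 hz00 heq
  have h0m : (0 : ℂ) ∈ ball (0 : ℂ) 1 := by simp
  have hmaps : MapsTo (fun z : ℂ => b * z) (ball 0 1) (ball 0 1) := fun z hz => mul_mem_ball hb hz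
  have hne : ∀ z ∈ ball (0 : ℂ) 1, z ≠ 0 → g z - g (b * z) ≠ 0 := by
    intro z hz hz0 h
    have := hg.univalent hz (hmaps hz) (sub_eq_zero.1 h)
    exact hb1 (mul_right_cancel₀ hz0 (by rw [one_mul]; exact this.symm))
  have hscale : ∀ u : ℂ → ℂ, DifferentiableOn ℂ u (ball 0 1) → ∀ z ∈ ball (0 : ℂ) 1,
      HasDerivAt (fun z => u z - u (b * z)) (deriv u z - deriv u (b * z) * b) z := by
    intro u hu z hz
    have hline : HasDerivAt (fun z : ℂ => b * z) b z := by
      simpa using (hasDerivAt_id z).const_mul b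
    have h1 : HasDerivAt u (deriv u (b * z)) ((fun z : ℂ => b * z) z) :=
      (hu.differentiableAt (isOpen_ball.mem_nhds (hmaps hz))).hasDerivAt
    exact (hu.differentiableAt (isOpen_ball.mem_nhds hz)).hasDerivAt.sub (h1.comp z hline)
  -- G is starlike by the two-point form of convexity. Libera's lemma makes C, with C' = G/z,
  -- starlike too. For A(z) = f(z) − f(bz) the quotient A'/C' has positive real part, so Libera's
  -- lemma again gives Re(A/C) > 0, and A cannot vanish off the origin.
  set G : ℂ → ℂ := fun z => g z - g (b * z) with hG
  have hGd := hscale g hg.analytic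
  have hGdiff : DifferentiableOn ℂ G (ball 0 1) := fun z hz =>
    (hGd z hz).differentiableAt.differentiableWithinAt
  have hG0 : G 0 = 0 := by simp [hG]
  have hG'0 : deriv G 0 = deriv g 0 * (1 - b) := by
    rw [(hGd 0 h0m).deriv, mul_zero]; ring
  have hG'0ne : deriv G 0 ≠ 0 := by
    rw [hG'0]; exact mul_ne_zero (hg.deriv_ne_zero h0m) (sub_ne_zero.2 hb1.symm)
  set Q : ℂ → ℂ := dslope G 0 with hQ
  have hQd : DifferentiableOn ℂ Q (ball 0 1) :=
    (Complex.differentiableOn_dslope (ball_mem_nhds 0 one_pos)).2 hGdiff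
  have hQ0 : Q 0 = deriv G 0 := by rw [hQ, dslope_same]
  have hQz : ∀ z ≠ 0, Q z = G z / z := fun z hz => by
    rw [hQ, dslope_of_ne _ hz, slope_def_field, hG0, sub_zero, sub_zero]
  have hQne : ∀ z ∈ ball (0 : ℂ) 1, Q z ≠ 0 := by
    intro z hz
    rcases eq_or_ne z 0 with rfl | hz0
    · rwa [hQ0]
    · rw [hQz z hz0]; exact div_ne_zero (hne z hz hz0) hz0
  have hP : ∀ z ∈ ball (0 : ℂ) 1, 0 < (deriv G z / Q z).re := by
    have hre : ∀ z ∈ ball (0 : ℂ) 1, 0 ≤ (deriv G z / Q z).re := by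
      intro z hz
      rcases eq_or_ne z 0 with rfl | hz0
      · rw [hQ0, div_self hG'0ne]; simp
      · have := hg.re_eulerOp_sub_div_nonneg hz hb
        rw [hQz z hz0, (hGd z hz).deriv]
        refine this.trans_eq (congrArg Complex.re ?_)
        rw [div_div_eq_mul_div]
        simp only [eulerOp, hG]
        ring
    intro z hz
    have h1 := norm_sub_one_le_of_re_nonneg (P := fun z => deriv G z / Q z)
      ((differentiableOn_deriv hGdiff).div hQd hQne) (by rw [hQ0, div_self hG'0ne]) hre hz
    refine lt_of_lt_of_le ?_ (le_re_of_norm_sub_one_le (norm_nonneg z) (mem_ball_zero_iff.1 hz) h1)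
    have h2 : ‖z‖ < 1 := mem_ball_zero_iff.1 hz
    have := norm_nonneg z
    apply div_pos <;> linarith
  obtain ⟨C₀, hC₀⟩ := hQd.isExactOn_ball
  set C : ℂ → ℂ := fun z => C₀ z - C₀ 0 with hC
  have hCd : ∀ z ∈ ball (0 : ℂ) 1, HasDerivAt C (Q z) z := fun z hz => (hC₀ z hz).sub_const _
  have hCdiff : DifferentiableOn ℂ C (ball 0 1) := fun z hz =>
    (hCd z hz).differentiableAt.differentiableWithinAt
  have hinv : ∀ w : ℂ, 0 < w.re → 0 < w⁻¹.re := fun w hw => by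
    rw [Complex.inv_re]
    refine div_pos hw (Complex.normSq_pos.2 ?_)
    rintro rfl; simp at hw
  have hC0 : C 0 = 0 := by simp [hC]
  have hCG : ∀ z ∈ ball (0 : ℂ) 1, z ≠ 0 → 0 < (C z / G z).re := by
    intro z hz hz0
    refine re_div_pos_of_starlike hGdiff hCdiff hG0 hC0 ?_ ?_ hz hz0
    · intro z hz hz0
      have := hP z hz
      rwa [hQz z hz0, div_div_eq_mul_div, mul_comm (deriv G z)] at this
    · intro z hz
      rw [(hCd z hz).deriv, ← inv_div]
      exact hinv _ (hP z hz)
  set A : ℂ → ℂ := fun z => f z - f (b * z) with hA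
  have hAd := hscale f hf
  have hAC := re_div_pos_of_starlike (X := A) hCdiff
    (fun z hz => (hAd z hz).differentiableAt.differentiableWithinAt) hC0 (by simp [hA]) ?_ ?_ hz₀
    hz00
  · simp only [hA, heq, sub_self, zero_div, Complex.zero_re] at hAC
    exact lt_irrefl _ hAC
  · intro z hz hz0
    rw [(hCd z hz).deriv, hQz z hz0, mul_div_cancel₀ _ hz0, ← inv_div]
    exact hinv _ (hCG z hz hz0)
  · intro z hz
    rw [(hCd z hz).deriv, (hAd z hz).deriv]
    rcases eq_or_ne z 0 with rfl | hz0
    · rw [hQ0, hG'0, mul_zero, ← mul_one_sub, mul_div_mul_right _ _ (sub_ne_zero.2 hb1.symm)]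
      exact hf0
    · have hbz : z ≠ b * z := fun h => hb1 (mul_right_cancel₀ hz0 (by rw [one_mul]; exact h.symm))
      have := hF z hz _ (hmaps hz) hbz
      rw [hQz z hz0]
      refine this.trans_eq (congrArg Complex.re ?_)
      rw [div_div_eq_mul_div]
      simp only [eulerOp, hG]
      ring

/-- If `F'/g'` has positive real part, so do the difference quotients of `F` with respect to `g`,
because the image of `g` is convex. -/
theorem re_sub_div_pos (hg : IsConvexMap g) {F : ℂ → ℂ} (hF : DifferentiableOn ℂ F (ball 0 1))
    (hp : ∀ z ∈ ball (0 : ℂ) 1, 0 < (deriv F z / deriv g z).re) {z w : ℂ}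
    (hz : z ∈ ball (0 : ℂ) 1) (hw : w ∈ ball (0 : ℂ) 1) (hzw : z ≠ w) :
    0 < ((F z - F w) / (g z - g w)).re := by
  obtain ⟨ho, -, ψ, hψ, hl⟩ := exists_holomorphic_inverse hg.analytic hg.univalent
  have hne : g z - g w ≠ 0 := sub_ne_zero.2 fun h => hzw (hg.univalent hz hw h)
  have hmem : ∀ t ∈ Icc (0 : ℝ) 1, g w + t * (g z - g w) ∈ g '' ball 0 1 := by
    intro t ht
    have := hg.convex_image (mem_image_of_mem g hw) (mem_image_of_mem g hz)
      (sub_nonneg.2 ht.2) ht.1 (by ring)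
    convert this using 1
    simp only [Complex.real_smul]
    push_cast
    ring
  have hd : ∀ y ∈ ball (0 : ℂ) 1, HasDerivAt (fun u => F (ψ u)) (deriv F y / deriv g y) (g y) := by
    intro y hy
    have h1 : DifferentiableAt ℂ ψ (g y) :=
      hψ.differentiableAt (ho.mem_nhds (mem_image_of_mem g hy))
    have h2 := h1.hasDerivAt.comp y (hg.hasDerivAt hy)
    have h3 : HasDerivAt (ψ ∘ g) 1 y := by
      refine (hasDerivAt_id y).congr_of_eventuallyEq ?_
      filter_upwards [isOpen_ball.mem_nhds hy] with x hx
      simp [hl x hx]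
    have h4 := eq_inv_of_mul_eq_one_left (h2.unique h3)
    have h5 : HasDerivAt F (deriv F y) (ψ (g y)) := by
      rw [hl y hy]; exact (hF.differentiableAt (isOpen_ball.mem_nhds hy)).hasDerivAt
    rw [div_eq_mul_inv, ← h4]
    exact h5.comp (g y) h1.hasDerivAt
  -- Noshiro–Warschawski argument: along the segment from g(w) to g(z), which lies in the convex
  -- image, the derivative of φ is a value of Re(F'/g').
  set φ : ℝ → ℝ := fun t => (F (ψ (g w + t * (g z - g w))) / (g z - g w)).re with hφ
  have hφd : ∀ t ∈ Icc (0 : ℝ) 1, ∃ d > 0, HasDerivAt φ d t := by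
    intro t ht
    obtain ⟨y, hy, hyt⟩ := hmem t ht
    refine ⟨_, hp y hy, ?_⟩
    have h1 : HasDerivAt (fun t : ℝ => g w + t * (g z - g w)) (g z - g w) t := by
      simpa using ((hasDerivAt_id t).ofReal_comp.mul_const (g z - g w)).const_add (g w)
    have h2 : HasDerivAt (fun u => F (ψ u)) (deriv F y / deriv g y)
        ((fun t : ℝ => g w + t * (g z - g w)) t) := by
      simp only
      rw [← hyt]
      exact hd y hy
    have h3 := (h2.comp t h1).div_const (g z - g w)
    have e : deriv F y / deriv g y = deriv F y / deriv g y * (g z - g w) / (g z - g w) := by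
      rw [mul_div_cancel_right₀ _ hne]
    rw [e]
    exact Complex.reCLM.hasFDerivAt.comp_hasDerivAt t h3
  have hmono : StrictMonoOn φ (Icc 0 1) := by
    refine strictMonoOn_of_deriv_pos (convex_Icc 0 1) (fun t ht => ?_) fun t ht => ?_
    · obtain ⟨d, -, h⟩ := hφd t ht
      exact h.continuousAt.continuousWithinAt
    · obtain ⟨d, hd, h⟩ := hφd t (interior_subset ht)
      rwa [h.deriv]
  have h01 := hmono (left_mem_Icc.2 zero_le_one) (right_mem_Icc.2 zero_le_one) zero_lt_one
  simp only [hφ, Complex.ofReal_zero, zero_mul, add_zero, Complex.ofReal_one, one_mul,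
    add_sub_cancel, hl w hw, hl z hz] at h01
  rw [sub_div, Complex.sub_re]
  linarith

end IsConvexMap

/-! ### Functions given by power series -/

theorem hasFPowerSeriesOnBall_of_hasSum {f : ℂ → ℂ} {a : ℕ → ℂ}
    (h : ∀ z ∈ ball (0 : ℂ) 1, HasSum (fun n => a n * z ^ n) (f z)) :
    HasFPowerSeriesOnBall f (FormalMultilinearSeries.ofScalars ℂ a) 0 1 := by
  refine ⟨ENNReal.le_of_forall_nnreal_lt fun r hr => ?_, one_pos, ?_⟩
  · refine FormalMultilinearSeries.le_radius_of_summable_norm _ ?_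
    have hr1 : (r : ℝ) < 1 := by exact_mod_cast hr
    have h1 := (h ((r : ℝ) : ℂ) (by simpa using hr1)).summable.norm
    refine h1.congr fun n => ?_
    simp
  · intro y hy
    have hy' : y ∈ ball (0 : ℂ) 1 := by
      rw [← Metric.eball_ofReal]; simpa using hy
    rw [zero_add]
    refine (h y hy').congr_fun ?_
    intro n
    simp [mul_comm]

theorem differentiableOn_of_hasSum {f : ℂ → ℂ} {a : ℕ → ℂ}
    (h : ∀ z ∈ ball (0 : ℂ) 1, HasSum (fun n => a n * z ^ n) (f z)) :
    DifferentiableOn ℂ f (ball 0 1) := by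
  have := (hasFPowerSeriesOnBall_of_hasSum h).differentiableOn
  rwa [← ENNReal.ofReal_one, Metric.eball_ofReal] at this

theorem taylorCoeff_eq_of_hasSum {f : ℂ → ℂ} {a : ℕ → ℂ}
    (h : ∀ z ∈ ball (0 : ℂ) 1, HasSum (fun n => a n * z ^ n) (f z)) (n : ℕ) :
    taylorCoeff f n = a n := by
  have h1 := hasFPowerSeriesOnBall_of_hasSum h
  have h2 := h1.hasFPowerSeriesAt.eq_formalMultilinearSeries h1.analyticAt.hasFPowerSeriesAt
  have h3 := congrArg (fun p => FormalMultilinearSeries.coeff p n) h2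
  simp only [FormalMultilinearSeries.coeff_ofScalars] at h3
  exact h3.symm

/-! ### The dilogarithm on the interval `[-1, 1]` -/

/-- The dilogarithm series `∑ xⁿ / n²`. -/
noncomputable def dilog (x : ℝ) : ℝ := ∑' n : ℕ, x ^ n / (n : ℝ) ^ 2

/-- The derivative of the dilogarithm, `∑ xⁿ / (n + 1)`. -/
noncomputable def dilogDeriv (x : ℝ) : ℝ := ∑' n : ℕ, x ^ n / ((n : ℝ) + 1)

theorem norm_dilog_term_le {x : ℝ} (hx : |x| ≤ 1) (n : ℕ) :
    ‖x ^ n / (n : ℝ) ^ 2‖ ≤ 1 / (n : ℝ) ^ 2 := by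
  rw [norm_div, norm_pow, norm_pow, Real.norm_natCast]
  gcongr
  exact pow_le_one₀ (norm_nonneg x) hx

theorem summable_dilog {x : ℝ} (hx : |x| ≤ 1) : Summable fun n : ℕ => x ^ n / (n : ℝ) ^ 2 :=
  Summable.of_norm_bounded hasSum_zeta_two.summable (norm_dilog_term_le hx)

theorem continuousOn_dilog : ContinuousOn dilog (Icc (-1) 1) := by
  refine continuousOn_tsum (fun n => by fun_prop) hasSum_zeta_two.summable fun n x hx => ?_
  exact norm_dilog_term_le (abs_le.2 hx) n

theorem dilog_neg_one : dilog (-1) = -(Real.pi ^ 2 / 12) := by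
  have h1 := hasSum_zeta_two
  have h2 := (summable_dilog (x := -1) (by simp)).hasSum
  have h3 := h1.add h2
  -- In ∑ (1 + (−1)ⁿ)/n² only even n = 2k survive, with terms 1/(2k²): half of ζ(2).
  have h4 : HasSum (fun n : ℕ => 1 / ((2 * n : ℕ) : ℝ) ^ 2
      + (-1 : ℝ) ^ (2 * n) / ((2 * n : ℕ) : ℝ) ^ 2)
      (Real.pi ^ 2 / 6 * (1 / 2)) := by
    refine (h1.mul_right (1 / 2)).congr_fun fun n => ?_
    rw [pow_mul]
    push_cast
    rcases eq_or_ne n 0 with rfl | hn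
    · simp
    · have : (n : ℝ) ≠ 0 := by exact_mod_cast hn
      field_simp
      norm_num
  have h5 : HasSum (fun n : ℕ => 1 / (n : ℝ) ^ 2 + (-1 : ℝ) ^ n / (n : ℝ) ^ 2)
      (Real.pi ^ 2 / 6 * (1 / 2)) := by
    have hinj : Function.Injective (fun n : ℕ => 2 * n) := fun a b h => by simpa using h
    refine (hinj.hasSum_iff (f := fun n : ℕ => 1 / (n : ℝ) ^ 2 + (-1 : ℝ) ^ n / (n : ℝ) ^ 2)
      fun n hn => ?_).1 h4
    have hodd : Odd n := by
      rw [← Nat.not_even_iff_odd]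
      rintro ⟨k, rfl⟩
      exact hn ⟨k, by simp only; ring⟩
    rw [hodd.neg_one_pow]
    ring
  have h6 := h3.unique h5
  rw [dilog]
  linarith

theorem hasDerivAt_dilog {x : ℝ} (hx : |x| < 1) : HasDerivAt dilog (dilogDeriv x) x := by
  set F : ℂ → ℂ := fun z => ∑' n : ℕ, (1 / (n : ℂ) ^ 2) * z ^ n with hF
  have hs : ∀ z ∈ ball (0 : ℂ) 1, HasSum (fun n : ℕ => (1 / (n : ℂ) ^ 2) * z ^ n) (F z) := by
    intro z hz
    refine (Summable.of_norm_bounded hasSum_zeta_two.summable fun n => ?_).hasSum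
    rw [norm_mul, norm_div, norm_pow, norm_pow, norm_one, Complex.norm_natCast]
    exact mul_le_of_le_one_right (by positivity)
      (pow_le_one₀ (norm_nonneg z) (mem_ball_zero_iff.1 hz).le)
  have hFd := differentiableOn_of_hasSum hs
  have hxm : (x : ℂ) ∈ ball (0 : ℂ) 1 := by simpa using hx
  have h1 := hasSum_taylorCoeff (differentiableOn_deriv hFd) hxm
  have h2 : HasSum (fun n : ℕ => x ^ n / ((n : ℝ) + 1)) (deriv F x).re := by
    refine (Complex.hasSum_re h1).congr_fun fun n => ?_
    rw [taylorCoeff_deriv, taylorCoeff_eq_of_hasSum hs]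
    have e : ((n : ℂ) + 1) * (1 / ((n + 1 : ℕ) : ℂ) ^ 2) * (x : ℂ) ^ n
        = ((x ^ n / ((n : ℝ) + 1) : ℝ) : ℂ) := by
      have : (n : ℂ) + 1 ≠ 0 := by exact_mod_cast n.succ_ne_zero
      push_cast
      field_simp
    rw [e, Complex.ofReal_re]
  have h3 := (hFd.differentiableAt (isOpen_ball.mem_nhds hxm)).hasDerivAt.real_of_complex
  rw [← h2.tsum_eq] at h3
  refine h3.congr_of_eventuallyEq ?_
  have hev : ∀ᶠ y : ℝ in 𝓝 x, |y| < 1 := (continuous_abs.tendsto x).eventually_lt_const hx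
  filter_upwards [hev] with y hy
  have h4 := Complex.hasSum_re (hs (y : ℂ) (by simpa using hy))
  rw [← h4.tsum_eq, dilog]
  refine tsum_congr fun n => ?_
  have e : (1 / (n : ℂ) ^ 2) * (y : ℂ) ^ n = ((y ^ n / (n : ℝ) ^ 2 : ℝ) : ℂ) := by
    push_cast; ring
  rw [e, Complex.ofReal_re]

theorem mul_dilogDeriv {x : ℝ} (hx : |x| < 1) : x * dilogDeriv x = -Real.log (1 - x) := by
  rw [← (Real.hasSum_pow_div_log_of_abs_lt_one hx).tsum_eq, dilogDeriv, ← tsum_mul_left]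
  exact tsum_congr fun n => by ring

theorem dilog_zero : dilog 0 = 0 := by
  rw [dilog, tsum_eq_single 0 fun n hn => by simp [hn]]; simp

theorem dilogDeriv_zero : dilogDeriv 0 = 1 := by
  rw [dilogDeriv, tsum_eq_single 0 fun n hn => by simp [hn]]; simp

/-! ### Coefficients and distortion in the class 𝒞₃ -/

/-- A lower bound for tilted real parts of a function with positive real part. -/
theorem le_re_mul_of_re_nonneg {p : ℂ → ℂ} (hp : DifferentiableOn ℂ p (ball 0 1))
    (hre : ∀ z ∈ ball (0 : ℂ) 1, 0 ≤ (p z).re) (h0 : 0 < (p 0).re) (v : ℂ) {z : ℂ}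
    (hz : z ∈ ball (0 : ℂ) 1) :
    (p 0).re * ((1 + ‖z‖ ^ 2) / (1 - ‖z‖ ^ 2) * v.re - 2 * ‖z‖ / (1 - ‖z‖ ^ 2) * ‖v‖)
      - (p 0).im * v.im ≤ (v * p z).re := by
  set c : ℝ := (p 0).re with hc
  set d : ℝ := (p 0).im with hd
  have hc0 : (c : ℂ) ≠ 0 := by exact_mod_cast h0.ne'
  have hp0 : p 0 = c + d * Complex.I := (Complex.re_add_im _).symm
  -- Normalized so that P(0) = 1, which confines P(z) to the disc of centre A and radius b.
  set P : ℂ → ℂ := fun z => (p z - d * Complex.I) / c with hP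
  have h1 : ‖P z - 1‖ ≤ ‖z‖ * ‖P z + 1‖ := by
    refine norm_sub_one_le_of_re_nonneg ((hp.sub_const _).div_const _) ?_ ?_ hz
    · rw [hp0, add_sub_cancel_right, div_self hc0]
    · intro z hz
      rw [Complex.div_ofReal_re]
      refine div_nonneg ?_ h0.le
      simpa using hre z hz
  have h2 := norm_sub_center_le (norm_nonneg z) (mem_ball_zero_iff.1 hz) h1
  set A : ℝ := (1 + ‖z‖ ^ 2) / (1 - ‖z‖ ^ 2) with hA
  set b : ℝ := 2 * ‖z‖ / (1 - ‖z‖ ^ 2) with hb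
  have h3 : v * p z = c * (v * (P z - A)) + (c * A * v + d * (v * Complex.I)) := by
    simp only [hP]; field_simp; ring
  have h4 : -(‖v‖ * b) ≤ (v * (P z - A)).re := by
    have h5 := Complex.abs_re_le_norm (v * (P z - A))
    rw [norm_mul] at h5
    have h6 := mul_le_mul_of_nonneg_left h2 (norm_nonneg v)
    linarith [neg_abs_le (v * (P z - A)).re]
  have h5 : (v * p z).re = c * (v * (P z - A)).re + (c * A * v.re - d * v.im) := by
    rw [h3]
    simp only [Complex.add_re, Complex.re_ofReal_mul, mul_assoc]
    simp
    ring
  rw [h5]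
  nlinarith [mul_le_mul_of_nonneg_left h4 h0.le]

section

variable {f g : ℂ → ℂ}

theorem deriv_eulerOp_zero (hf : DifferentiableOn ℂ f (ball 0 1)) :
    deriv (eulerOp f) 0 = deriv f 0 := by
  rw [← taylorCoeff_one, ← taylorCoeff_one, taylorCoeff_eulerOp hf]
  simp

theorem eulerOp_zero (f : ℂ → ℂ) : eulerOp f 0 = 0 := zero_mul _

/-- The hypotheses shared by the distortion estimates: `f'(0) = 1` and
`Re ((z (z f')')' / (z g')') > 0` with `g` convex. -/
structure CloseToConvexPair (f g : ℂ → ℂ) : Prop where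
  analytic : DifferentiableOn ℂ f (ball 0 1)
  convex : IsConvexMap g
  map_zero : f 0 = 0
  deriv_zero : deriv f 0 = 1
  re_pos : ∀ z ∈ ball (0 : ℂ) 1, 0 < (deriv (eulerOp (eulerOp f)) z / deriv (eulerOp g) z).re

theorem NormalizedC3.exists_pair (hf : NormalizedC3 f) : ∃ g, CloseToConvexPair f g := by
  obtain ⟨g, hg, hp⟩ := hf.mem.exists_convex
  exact ⟨g, hf.mem.analytic, hg, hf.map_zero, hf.deriv_zero, hp⟩

namespace CloseToConvexPair

theorem analytic₁ (h : CloseToConvexPair f g) : DifferentiableOn ℂ (eulerOp f) (ball 0 1) :=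
  differentiableOn_eulerOp h.analytic

theorem analytic₂ (h : CloseToConvexPair f g) :
    DifferentiableOn ℂ (eulerOp (eulerOp f)) (ball 0 1) :=
  differentiableOn_eulerOp h.analytic₁

theorem analytic_eulerOp (h : CloseToConvexPair f g) : DifferentiableOn ℂ (eulerOp g) (ball 0 1) :=
  differentiableOn_eulerOp h.convex.analytic

theorem deriv_ne_zero (h : CloseToConvexPair f g) {z : ℂ} (hz : z ∈ ball (0 : ℂ) 1) :
    deriv (eulerOp g) z ≠ 0 := by
  intro h0
  have := h.re_pos z hz
  simp [h0] at this

theorem differentiableOn_ratio (h : CloseToConvexPair f g) :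
    DifferentiableOn ℂ (fun z => deriv (eulerOp (eulerOp f)) z / deriv (eulerOp g) z)
      (ball 0 1) :=
  (differentiableOn_deriv h.analytic₂).div (differentiableOn_deriv h.analytic_eulerOp)
    fun _ hz => h.deriv_ne_zero hz

theorem ratio_zero (h : CloseToConvexPair f g) :
    deriv (eulerOp (eulerOp f)) 0 / deriv (eulerOp g) 0 = (deriv g 0)⁻¹ := by
  rw [deriv_eulerOp_zero h.analytic₁, deriv_eulerOp_zero h.analytic,
    deriv_eulerOp_zero h.convex.analytic, h.deriv_zero, one_div]

/-- The coefficient bound in the class `𝒞₃`. -/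
theorem norm_taylorCoeff_le (h : CloseToConvexPair f g) {n : ℕ} (hn : n ≠ 0) :
    ‖taylorCoeff f n‖ ≤ 2 / 3 + 1 / (3 * (n : ℝ) ^ 2) := by
  obtain ⟨m, rfl⟩ := Nat.exists_eq_succ_of_ne_zero hn
  set B := ‖deriv g 0‖ with hB
  have hB0 : 0 < B := norm_pos_iff.2 (h.convex.deriv_ne_zero (mem_ball_self one_pos))
  set p : ℂ → ℂ := fun z => deriv (eulerOp (eulerOp f)) z / deriv (eulerOp g) z with hp
  have hp0 : p 0 = (deriv g 0)⁻¹ := h.ratio_zero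
  -- Since 2 Re p(0) ≤ 2/B, the factor B in Loewner's bound will cancel, whatever the argument of
  -- g'(0).
  have hpk : ∀ k, ‖taylorCoeff p k‖ ≤ (if k = 0 then 1 else 2) / B := by
    intro k
    split_ifs with hk
    · rw [hk, taylorCoeff_zero, hp0, norm_inv, one_div]
    · refine (norm_taylorCoeff_le_of_re_nonneg h.differentiableOn_ratio
        (fun z hz => (h.re_pos z hz).le) hk).trans ?_
      have h1 : (p 0).re ≤ 1 / B := by
        refine (Complex.re_le_norm _).trans_eq ?_
        rw [hp0, norm_inv, one_div]
      calc 2 * (p 0).re ≤ 2 * (1 / B) := by gcongr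
        _ = 2 / B := by ring
  have h1 := taylorCoeff_mul h.differentiableOn_ratio
    (differentiableOn_deriv h.analytic_eulerOp) m
  have h2 : taylorCoeff (fun z => p z * deriv (eulerOp g) z) m
      = ((m : ℂ) + 1) ^ 3 * taylorCoeff f (m + 1) := by
    rw [taylorCoeff_congr (g := deriv (eulerOp (eulerOp f)))
      (fun z hz => div_mul_cancel₀ _ (h.deriv_ne_zero hz)), taylorCoeff_deriv,
      taylorCoeff_eulerOp h.analytic₁, taylorCoeff_eulerOp h.analytic]
    push_cast
    ring
  have h3 : ∀ k ∈ Finset.range (m + 1), ‖taylorCoeff p k * taylorCoeff (deriv (eulerOp g)) (m - k)‖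
      ≤ (if k = 0 then 1 else 2) * ((m - k : ℕ) + 1 : ℝ) ^ 2 := by
    intro k _
    rw [norm_mul, taylorCoeff_deriv, taylorCoeff_eulerOp h.convex.analytic, norm_mul, norm_mul]
    have e1 : ‖((m - k : ℕ) : ℂ) + 1‖ = ((m - k : ℕ) : ℝ) + 1 := by
      have := Complex.norm_natCast ((m - k) + 1)
      push_cast at this ⊢
      exact this
    have e2 : ‖(((m - k) + 1 : ℕ) : ℂ)‖ = ((m - k : ℕ) : ℝ) + 1 := by
      rw [Complex.norm_natCast]; push_cast; rfl
    rw [e1, e2]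
    calc _ ≤ (if k = 0 then 1 else 2) / B *
          ((((m - k : ℕ) : ℝ) + 1) * ((((m - k : ℕ) : ℝ) + 1) * B)) := by
          have := hpk k
          have := h.convex.norm_taylorCoeff_le (m - k + 1)
          gcongr
      _ = _ := by field_simp
  have h4 : ((m : ℝ) + 1) ^ 3 * ‖taylorCoeff f (m + 1)‖
      ≤ ∑ k ∈ Finset.range (m + 1), (if k = 0 then 1 else 2) * ((m - k : ℕ) + 1 : ℝ) ^ 2 := by
    have e : ((m : ℝ) + 1) ^ 3 * ‖taylorCoeff f (m + 1)‖
        = ‖((m : ℂ) + 1) ^ 3 * taylorCoeff f (m + 1)‖ := by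
      rw [norm_mul, norm_pow]
      have := Complex.norm_natCast (m + 1)
      push_cast at this
      rw [this]
    rw [e, ← h2, h1]
    exact norm_sum_le_of_le _ h3
  have h5 : ∀ m : ℕ, ∑ j ∈ Finset.range m, 2 * ((j : ℝ) + 1) ^ 2
      = (m : ℝ) * (m + 1) * (2 * m + 1) / 3 := by
    intro m
    induction m with
    | zero => simp
    | succ k ih => rw [Finset.sum_range_succ, ih]; push_cast; ring
  have h6 : ∑ k ∈ Finset.range (m + 1), (if k = 0 then 1 else 2) * ((m - k : ℕ) + 1 : ℝ) ^ 2
      = ((m : ℝ) + 1) ^ 2 + m * (m + 1) * (2 * m + 1) / 3 := by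
    rw [Finset.sum_range_succ', ← h5,
      ← Finset.sum_range_reflect (fun j : ℕ => 2 * ((j : ℝ) + 1) ^ 2)]
    simp only [Nat.add_eq_zero_iff, one_ne_zero, and_false, if_false, if_true,
      Nat.sub_zero, one_mul]
    rw [add_comm]
    congr 1
    refine Finset.sum_congr rfl fun k _ => ?_
    rw [show m - (k + 1) = m - 1 - k by omega]
  rw [h6] at h4
  have hm : (0 : ℝ) < (m : ℝ) + 1 := by positivity
  have h7 : ‖taylorCoeff f (m + 1)‖
      ≤ (((m : ℝ) + 1) ^ 2 + m * (m + 1) * (2 * m + 1) / 3) / ((m : ℝ) + 1) ^ 3 := by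
    rw [le_div_iff₀ (by positivity)]; linarith
  refine h7.trans_eq ?_
  push_cast
  field_simp
  ring

/-- Integrated tilted real part estimate for `z (z f')'`. -/
theorem le_norm_of_tilt (h : CloseToConvexPair f g) (v : ℂ) {T T' : ℝ → ℝ} (T0 : T 0 = 0) {ρ : ℝ}
    (hρ : ρ < 1) (hT : ∀ s ∈ Icc 0 ρ, HasDerivAt T (T' s) s) (hT' : ∀ s ∈ Icc 0 ρ, 0 ≤ T' s)
    (hb : ∀ z : ℂ, ‖z‖ ≤ ρ → T' ‖z‖ ≤ ‖deriv g 0‖ * ((1 - ‖z‖) / (1 + ‖z‖) ^ 3) *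
      (v * (deriv (eulerOp (eulerOp f)) z / deriv (eulerOp g) z)).re) {z : ℂ} (hz : ‖z‖ ≤ ρ) :
    T ‖z‖ ≤ ‖eulerOp g z‖ * (v * (eulerOp (eulerOp f) z / eulerOp g z)).re := by
  refine le_norm_mul_re_of_starlike h.analytic_eulerOp h.analytic₂ (eulerOp_zero _)
    (eulerOp_zero _) (fun z hz hz0 => h.convex.eulerOp_starlike hz hz0) hρ T0
    (fun s hs => (hT s hs).continuousAt.continuousWithinAt)
    (fun s hs => hT s (Ioc_subset_Icc_self hs)) (fun s hs => hT' s (Ioc_subset_Icc_self hs)) ?_ hz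
  intro z hz0 hz
  have hz1 : z ∈ ball (0 : ℂ) 1 := mem_ball_zero_iff.2 (hz.trans_lt hρ)
  have h1 := hb z hz
  have h2 := hT' ‖z‖ ⟨norm_nonneg z, hz⟩
  have h3 := h.convex.le_norm_deriv_eulerOp hz1
  have h4 : 0 < ‖deriv g 0‖ * ((1 - ‖z‖) / (1 + ‖z‖) ^ 3) := by
    have := norm_pos_iff.2 (h.convex.deriv_ne_zero (mem_ball_self one_pos))
    have := norm_nonneg z
    have : 0 < 1 - ‖z‖ := by linarith
    positivity
  have h5 : 0 ≤ (v * (deriv (eulerOp (eulerOp f)) z / deriv (eulerOp g) z)).re :=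
    nonneg_of_mul_nonneg_right (h2.trans h1) h4
  exact h1.trans (mul_le_mul_of_nonneg_right h3 h5)

theorem re_ratio_zero (h : CloseToConvexPair f g) :
    ‖deriv g 0‖ * ((deriv g 0)⁻¹).re = (deriv g 0).re / ‖deriv g 0‖ := by
  have : ‖deriv g 0‖ ≠ 0 := norm_ne_zero_iff.2 (h.convex.deriv_ne_zero (mem_ball_self one_pos))
  rw [Complex.inv_re, Complex.normSq_eq_norm_sq]
  field_simp

/-- The integrand is the product of (1 − s)/(1 + s)³, from |(zg')'|, and (1 − s)/(1 + s), from Re p.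
-/
theorem hasDerivAt_firstBound {s : ℝ} (hs : 0 ≤ s) :
    HasDerivAt (fun s : ℝ => (s ^ 3 / 3 + s) / (1 + s) ^ 3) ((1 - s) ^ 2 / (1 + s) ^ 4) s := by
  have hne : 1 + s ≠ 0 := by positivity
  have h1 : HasDerivAt (fun s : ℝ => s ^ 3 / 3 + s) (s ^ 2 + 1) s := by
    have := ((hasDerivAt_pow 3 s).div_const 3).add (hasDerivAt_id s)
    have e : s ^ 2 + 1 = (3 : ℕ) * s ^ (3 - 1) / 3 + 1 := by push_cast; ring
    rw [e]; exact this
  have h2 : HasDerivAt (fun s : ℝ => (1 + s) ^ 3) (3 * (1 + s) ^ 2) s := by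
    simpa using ((hasDerivAt_id s).const_add 1).fun_pow 3
  have e : (1 - s) ^ 2 / (1 + s) ^ 4
      = ((s ^ 2 + 1) * (1 + s) ^ 3 - (s ^ 3 / 3 + s) * (3 * (1 + s) ^ 2)) / ((1 + s) ^ 3) ^ 2 := by
    field_simp
    ring
  rw [e]
  exact h1.div h2 (pow_ne_zero _ hne)

/-- Lower bound for `z (z f')'`, without a tilt. -/
theorem first_bound (h : CloseToConvexPair f g) {z : ℂ} (hz : z ∈ ball (0 : ℂ) 1) :
    (deriv g 0).re / ‖deriv g 0‖ * ((‖z‖ ^ 3 / 3 + ‖z‖) / (1 + ‖z‖) ^ 3)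
      ≤ ‖eulerOp g z‖ * (eulerOp (eulerOp f) z / eulerOp g z).re := by
  set c := (deriv g 0).re / ‖deriv g 0‖ with hc
  have hB := norm_pos_iff.2 (h.convex.deriv_ne_zero (mem_ball_self one_pos))
  have hc0 : 0 ≤ c := div_nonneg h.convex.re_deriv_pos.le hB.le
  rw [← one_mul (eulerOp (eulerOp f) z / eulerOp g z)]
  refine h.le_norm_of_tilt 1 (T := fun s => c * ((s ^ 3 / 3 + s) / (1 + s) ^ 3))
    (T' := fun s => c * ((1 - s) ^ 2 / (1 + s) ^ 4)) (by simp) (mem_ball_zero_iff.1 hz)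
    (fun s hs => (hasDerivAt_firstBound hs.1).const_mul c) (fun s hs => by have := hs.1; positivity)
    ?_ le_rfl
  intro w hw
  have hw1 : ‖w‖ < 1 := hw.trans_lt (mem_ball_zero_iff.1 hz)
  have h1 := le_re_mul_of_re_nonneg h.differentiableOn_ratio (fun z hz => (h.re_pos z hz).le)
    (h.re_pos 0 (mem_ball_self one_pos)) 1 (mem_ball_zero_iff.2 hw1)
  simp only [h.ratio_zero, Complex.one_re, Complex.one_im, norm_one, mul_one, mul_zero,
    sub_zero] at h1
  have hs := norm_nonneg w
  have hs' : 0 < 1 - ‖w‖ := by linarith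
  refine le_trans (le_of_eq ?_) (mul_le_mul_of_nonneg_left h1 (by positivity))
  rw [hc, ← h.re_ratio_zero]
  have e : 1 - ‖w‖ ^ 2 = (1 - ‖w‖) * (1 + ‖w‖) := by ring
  rw [e]
  field_simp
  ring

end CloseToConvexPair

end

theorem norm_mul_norm_div_le (x y : ℂ) : ‖y‖ * ‖x / y‖ ≤ ‖x‖ := by
  rcases eq_or_ne y 0 with rfl | hy
  · simp
  · rw [← norm_mul, mul_div_cancel₀ _ hy]

section

variable {f g : ℂ → ℂ}

namespace CloseToConvexPair

theorem norm_deriv_pos (h : CloseToConvexPair f g) : 0 < ‖deriv g 0‖ :=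
  norm_pos_iff.2 (h.convex.deriv_ne_zero (mem_ball_self one_pos))

theorem cos_pos (h : CloseToConvexPair f g) : 0 < (deriv g 0).re / ‖deriv g 0‖ :=
  div_pos h.convex.re_deriv_pos h.norm_deriv_pos

theorem cos_le_one (_h : CloseToConvexPair f g) : (deriv g 0).re / ‖deriv g 0‖ ≤ 1 :=
  div_le_one_of_le₀ (Complex.re_le_norm _) (norm_nonneg _)

/-- The integrand is the lower bound for |(zg')'| times that for the tilted real part of p, up to
normalization. At c = 1 it is the untilted one. -/
theorem hasDerivAt_tiltBound (c : ℝ) {s : ℝ} (hs : 0 ≤ s) :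
    HasDerivAt (fun s : ℝ => ((s ^ 3 + 3 * s ^ 2 + 3 * s) - c * (s ^ 3 + 3 * s ^ 2)
      + (2 * c ^ 2 - 1) * s ^ 3) / (3 * (1 + s) ^ 3))
      ((1 - 2 * c * s + (2 * c ^ 2 - 1) * s ^ 2) / (1 + s) ^ 4) s := by
  have hne : 1 + s ≠ 0 := by positivity
  have h1 : HasDerivAt (fun s : ℝ => (s ^ 3 + 3 * s ^ 2 + 3 * s) - c * (s ^ 3 + 3 * s ^ 2)
      + (2 * c ^ 2 - 1) * s ^ 3)
      ((3 * s ^ 2 + 3 * (2 * s) + 3 * 1) - c * (3 * s ^ 2 + 3 * (2 * s))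
        + (2 * c ^ 2 - 1) * (3 * s ^ 2)) s := by
    have a1 : HasDerivAt (fun s : ℝ => s ^ 3) (3 * s ^ 2) s := by
      simpa using hasDerivAt_pow 3 s
    have a2 : HasDerivAt (fun s : ℝ => s ^ 2) (2 * s) s := by
      simpa using hasDerivAt_pow 2 s
    exact (((a1.add (a2.const_mul 3)).add ((hasDerivAt_id s).const_mul 3)).sub
      ((a1.add (a2.const_mul 3)).const_mul c)).add (a1.const_mul _)
  have h2 : HasDerivAt (fun s : ℝ => 3 * (1 + s) ^ 3) (3 * (3 * (1 + s) ^ 2)) s := by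
    have : HasDerivAt (fun s : ℝ => (1 + s) ^ 3) (3 * (1 + s) ^ 2) s := by
      simpa using ((hasDerivAt_id s).const_add 1).fun_pow 3
    exact this.const_mul 3
  refine (h1.div h2 (by positivity)).congr_deriv ?_
  field_simp
  ring

/-- Lower bound for `z (z f')'`, tilted by the argument of `g'(0)`. -/
theorem tilt_bound (h : CloseToConvexPair f g) {z : ℂ} (hz : ‖z‖ ≤ 7 / 10) :
    (‖z‖ ^ 3 / 3 + ‖z‖) / (1 + ‖z‖) ^ 3
      + (1 - (deriv g 0).re / ‖deriv g 0‖) * (‖z‖ ^ 2 * (4 / 5 - 7 / 4 * ‖z‖))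
      ≤ ‖eulerOp (eulerOp f) z‖ := by
  set c := (deriv g 0).re / ‖deriv g 0‖ with hc
  have hB := h.norm_deriv_pos
  have hc0 : 0 < c := h.cos_pos
  have hc1 : c ≤ 1 := h.cos_le_one
  set p₀ : ℂ := (deriv g 0)⁻¹ with hp₀
  -- The unimodular v with vp(0) > 0; its real part is c.
  set v : ℂ := (‖deriv g 0‖ : ℝ) * starRingEnd ℂ p₀ with hv
  have hcB : ‖deriv g 0‖ * p₀.re = c := h.re_ratio_zero
  have hvre : v.re = c := by rw [hv, Complex.re_ofReal_mul, Complex.conj_re, hcB]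
  have hvim : v.im = -(‖deriv g 0‖ * p₀.im) := by
    rw [hv, Complex.im_ofReal_mul, Complex.conj_im]; ring
  have hvn : ‖v‖ = 1 := by
    rw [hv, norm_mul, Complex.norm_real, norm_norm, RCLike.norm_conj, hp₀, norm_inv,
      mul_inv_cancel₀ hB.ne']
  have hsq : c ^ 2 + (‖deriv g 0‖ * p₀.im) ^ 2 = 1 := by
    have h1 := Complex.sq_norm v
    rw [hvn, Complex.normSq_apply, hvre, hvim] at h1
    linarith
  have key := h.le_norm_of_tilt v
    (T := fun s : ℝ => ((s ^ 3 + 3 * s ^ 2 + 3 * s) - c * (s ^ 3 + 3 * s ^ 2)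
      + (2 * c ^ 2 - 1) * s ^ 3) / (3 * (1 + s) ^ 3))
    (T' := fun s : ℝ => (1 - 2 * c * s + (2 * c ^ 2 - 1) * s ^ 2) / (1 + s) ^ 4) (by simp)
    (ρ := 7 / 10) (by norm_num) (fun s hs => hasDerivAt_tiltBound c hs.1) ?_ ?_ hz
  · have h1 : ‖eulerOp g z‖ * (v * (eulerOp (eulerOp f) z / eulerOp g z)).re
        ≤ ‖eulerOp (eulerOp f) z‖ := by
      refine (mul_le_mul_of_nonneg_left (Complex.re_le_norm _) (norm_nonneg _)).trans ?_
      rw [norm_mul, hvn, one_mul]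
      exact norm_mul_norm_div_le _ _
    refine le_trans ?_ (key.trans h1)
    have hs := norm_nonneg z
    generalize ‖z‖ = s at hs
    -- The right-hand side times (1 − c)s² is the excess over the case c = 1. Two further
    -- integrations turn 4/5 and 7/4 into 1/5 and 7/36, and 1/5 > 7/36 is what the covering theorem
    -- needs.
    have hpoly : 4 / 5 - 7 / 4 * s ≤ (3 - 3 * s + 2 * (1 - c) * s) / (3 * (1 + s) ^ 3) := by
      rw [le_div_iff₀ (by positivity)]
      nlinarith [mul_nonneg hs (sq_nonneg (s - 1 / 5)), mul_nonneg (sub_nonneg.2 hc1) hs,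
        pow_nonneg hs 4, sq_nonneg (s - 1 / 5)]
    have h2 := mul_le_mul_of_nonneg_left hpoly
      (mul_nonneg (sub_nonneg.2 hc1) (sq_nonneg s))
    have e : ((s ^ 3 + 3 * s ^ 2 + 3 * s) - c * (s ^ 3 + 3 * s ^ 2)
        + (2 * c ^ 2 - 1) * s ^ 3) / (3 * (1 + s) ^ 3)
        = (s ^ 3 / 3 + s) / (1 + s) ^ 3
          + (1 - c) * s ^ 2 * ((3 - 3 * s + 2 * (1 - c) * s) / (3 * (1 + s) ^ 3)) := by
      field_simp
      ring
    rw [e, ← mul_assoc]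
    linarith
  · intro s hs
    -- This is (2cs − 1)²/2 + 1/2 − s², nonnegative for s ≤ 1/√2; hence the cut-off 7/10.
    have : 0 ≤ 1 - 2 * c * s + (2 * c ^ 2 - 1) * s ^ 2 := by
      have := hs.1; have := hs.2
      nlinarith [sq_nonneg (2 * (c * s) - 1)]
    have := hs.1
    positivity
  · intro w hw
    have hw1 : ‖w‖ < 1 := hw.trans_lt (by norm_num)
    have h1 := le_re_mul_of_re_nonneg h.differentiableOn_ratio (fun z hz => (h.re_pos z hz).le)
      (h.re_pos 0 (mem_ball_self one_pos)) v (mem_ball_zero_iff.2 hw1)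
    simp only [h.ratio_zero, hvre, hvim, hvn, mul_one, ← hp₀] at h1
    have hs := norm_nonneg w
    have hs' : 0 < 1 - ‖w‖ := by linarith
    refine le_trans (le_of_eq ?_)
      (mul_le_mul_of_nonneg_left h1 (mul_nonneg hB.le (by positivity)))
    have e : 1 - ‖w‖ ^ 2 = (1 - ‖w‖) * (1 + ‖w‖) := by ring
    have e2 : ‖deriv g 0‖ * ((1 - ‖w‖) / (1 + ‖w‖) ^ 3) *
        (p₀.re * ((1 + ‖w‖ ^ 2) / (1 - ‖w‖ ^ 2) * c - 2 * ‖w‖ / (1 - ‖w‖ ^ 2))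
          - p₀.im * -(‖deriv g 0‖ * p₀.im))
        = ((1 - ‖w‖) / (1 + ‖w‖) ^ 3) *
          (‖deriv g 0‖ * p₀.re * ((1 + ‖w‖ ^ 2) / (1 - ‖w‖ ^ 2) * c - 2 * ‖w‖ / (1 - ‖w‖ ^ 2))
          + (‖deriv g 0‖ * p₀.im) ^ 2) := by ring
    rw [e2, hcB, eq_sub_of_add_eq' hsq, e]
    field_simp
    ring

theorem first_bound_norm (h : CloseToConvexPair f g) {z : ℂ} (hz : z ∈ ball (0 : ℂ) 1) :
    (deriv g 0).re / ‖deriv g 0‖ * ((‖z‖ ^ 3 / 3 + ‖z‖) / (1 + ‖z‖) ^ 3)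
      ≤ ‖eulerOp (eulerOp f) z‖ := by
  refine (h.first_bound hz).trans
    ((mul_le_mul_of_nonneg_left (Complex.re_le_norm _) (norm_nonneg _)).trans ?_)
  exact norm_mul_norm_div_le _ _

/-- Beyond |z| = 7/10 the correction is so negative that the bound with factor c suffices: (s³/3 +
s)/(1 + s)³ ≤ 1/6 ≤ s²(7s/4 − 4/5). -/
theorem second_bound_norm (h : CloseToConvexPair f g) {z : ℂ} (hz : z ∈ ball (0 : ℂ) 1) :
    (‖z‖ ^ 3 / 3 + ‖z‖) / (1 + ‖z‖) ^ 3
      + (1 - (deriv g 0).re / ‖deriv g 0‖) * (‖z‖ ^ 2 * (4 / 5 - 7 / 4 * ‖z‖))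
      ≤ ‖eulerOp (eulerOp f) z‖ := by
  rcases le_or_gt ‖z‖ (7 / 10) with hz7 | hz7
  · exact h.tilt_bound hz7
  refine le_trans ?_ (h.first_bound_norm hz)
  have hc1 := h.cos_le_one
  generalize (deriv g 0).re / ‖deriv g 0‖ = c at hc1
  have hz1 : ‖z‖ < 1 := mem_ball_zero_iff.1 hz
  generalize ‖z‖ = s at hz7 hz1
  have h1 : (s ^ 3 / 3 + s) / (1 + s) ^ 3 ≤ 1 / 6 := by
    rw [div_le_iff₀ (by positivity)]
    nlinarith [pow_pos (sub_pos.2 hz1) 3]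
  have h2 : 1 / 6 ≤ s ^ 2 * (7 / 4 * s - 4 / 5) := by nlinarith
  nlinarith

/-- Libera's lemma for h = zg' and X = z(zf')'; the common factor z cancels. -/
theorem re_eulerOp_div_pos (h : CloseToConvexPair f g) {z : ℂ} (hz : z ∈ ball (0 : ℂ) 1) :
    0 < (deriv (eulerOp f) z / deriv g z).re := by
  rcases eq_or_ne z 0 with rfl | hz0
  · rw [deriv_eulerOp_zero h.analytic, h.deriv_zero, one_div, Complex.inv_re]
    exact div_pos h.convex.re_deriv_pos
      (Complex.normSq_pos.2 (h.convex.deriv_ne_zero (mem_ball_self one_pos)))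
  · have := re_div_pos_of_starlike h.analytic_eulerOp h.analytic₂ (eulerOp_zero _)
      (eulerOp_zero _) (fun z hz hz0 => h.convex.eulerOp_starlike hz hz0) h.re_pos hz hz0
    rwa [eulerOp, eulerOp, mul_div_mul_left _ _ hz0] at this

theorem injOn_eulerOp (h : CloseToConvexPair f g) : InjOn (eulerOp f) (ball 0 1) := by
  intro z hz w hw hzw
  by_contra hne
  have := h.convex.re_sub_div_pos h.analytic₁ (fun z hz => h.re_eulerOp_div_pos hz) hz hw hne
  simp [hzw] at this

theorem injOn (h : CloseToConvexPair f g) : InjOn f (ball 0 1) := by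
  refine h.convex.injOn_of_re_sub_div_pos h.analytic ?_ fun z hz w hw hne =>
    h.convex.re_sub_div_pos h.analytic₁ (fun z hz => h.re_eulerOp_div_pos hz) hz hw hne
  have := h.re_eulerOp_div_pos (mem_ball_self one_pos)
  rwa [deriv_eulerOp_zero h.analytic] at this

end CloseToConvexPair

end

/-! ### Growth and covering -/

theorem hasDerivAt_div_sq_add_log {s : ℝ} (hs : 0 ≤ s) :
    HasDerivAt (fun s : ℝ => 2 / 3 * (s / (1 + s) ^ 2) + 1 / 3 * Real.log (1 + s))
      ((s ^ 2 / 3 + 1) / (1 + s) ^ 3) s := by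
  have hne : 1 + s ≠ 0 := by positivity
  have h0 : HasDerivAt (fun s : ℝ => 1 + s) 1 s := (hasDerivAt_id s).const_add 1
  have h1 : HasDerivAt (fun s : ℝ => (1 + s) ^ 2) (2 * (1 + s)) s := by
    simpa using h0.fun_pow 2
  refine ((((hasDerivAt_id s).div h1 (pow_ne_zero _ hne)).const_mul (2 / 3)).add
    ((h0.log hne).const_mul (1 / 3))).congr_deriv ?_
  simp only [id]
  field_simp
  ring

theorem hasDerivAt_cubic (e a b : ℝ) (s : ℝ) :
    HasDerivAt (fun s : ℝ => e * (a * s ^ 2 - b * s ^ 3)) (e * (2 * a * s - 3 * b * s ^ 2)) s := by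
  have a1 : HasDerivAt (fun s : ℝ => s ^ 3) (3 * s ^ 2) s := by
    simpa using hasDerivAt_pow 3 s
  have a2 : HasDerivAt (fun s : ℝ => s ^ 2) (2 * s) s := by
    simpa using hasDerivAt_pow 2 s
  exact (((a2.const_mul a).sub (a1.const_mul b)).const_mul e).congr_deriv (by ring)

/-- Multiplied by s, this derivative is the growth bound for zf' in the case c = 1, because s ·
dilogDeriv(−s) = log(1 + s). -/
theorem hasDerivAt_div_add_dilog {s : ℝ} (hs : 0 ≤ s) (hs1 : s < 1) :
    HasDerivAt (fun s : ℝ => 2 / 3 * (s / (1 + s)) - 1 / 3 * dilog (-s))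
      (2 / 3 * (1 / (1 + s) ^ 2) + 1 / 3 * dilogDeriv (-s)) s := by
  have hne : 1 + s ≠ 0 := by positivity
  have h0 : HasDerivAt (fun s : ℝ => 1 + s) 1 s := (hasDerivAt_id s).const_add 1
  have h1 : HasDerivAt dilog (dilogDeriv (-s)) (-s) :=
    hasDerivAt_dilog (by rwa [abs_neg, abs_of_nonneg hs])
  have h2 : HasDerivAt (fun s : ℝ => dilog (-s)) (dilogDeriv (-s) * -1) s :=
    h1.comp s (hasDerivAt_neg s)
  refine ((((hasDerivAt_id s).div h0 hne).const_mul (2 / 3)).sub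
    (h2.const_mul (1 / 3))).congr_deriv ?_
  simp only [id]
  field_simp
  ring

theorem mul_dilogDeriv_neg {s : ℝ} (hs : 0 ≤ s) (hs1 : s < 1) :
    s * dilogDeriv (-s) = Real.log (1 + s) := by
  have := mul_dilogDeriv (x := -s) (by rwa [abs_neg, abs_of_nonneg hs])
  rw [sub_neg_eq_add] at this
  linarith

theorem half_le_dilogDeriv_neg {s : ℝ} (hs : 0 ≤ s) (hs1 : s < 1) : 1 / 2 ≤ dilogDeriv (-s) := by
  rcases hs.eq_or_lt with rfl | hs0
  · rw [neg_zero, dilogDeriv_zero]; norm_num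
  have h1 := mul_dilogDeriv_neg hs hs1
  have h2 := Real.one_sub_inv_le_log_of_pos (show 0 < 1 + s by linarith)
  have h3 : s * (1 / 2) ≤ 1 - (1 + s)⁻¹ := by
    have : 1 - (1 + s)⁻¹ = s / (1 + s) := by field_simp; ring
    rw [this, le_div_iff₀ (by positivity)]
    nlinarith
  exact le_of_mul_le_mul_left (h3.trans (h2.trans_eq h1.symm)) hs0

section

variable {f g : ℂ → ℂ}

namespace CloseToConvexPair

/-- The growth estimate for `z f'`. -/
theorem le_norm_eulerOp (h : CloseToConvexPair f g) {z : ℂ} (hz : z ∈ ball (0 : ℂ) 1) :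
    2 / 3 * (‖z‖ / (1 + ‖z‖) ^ 2) + 1 / 3 * Real.log (1 + ‖z‖)
      + (1 - (deriv g 0).re / ‖deriv g 0‖) * (2 / 5 * ‖z‖ ^ 2 - 7 / 12 * ‖z‖ ^ 3)
      ≤ ‖eulerOp f z‖ := by
  set c := (deriv g 0).re / ‖deriv g 0‖ with hc
  have hc0 : 0 < c := h.cos_pos
  have hc1 : c ≤ 1 := h.cos_le_one
  set A : ℝ → ℝ := fun s => (s ^ 2 / 3 + 1) / (1 + |s|) ^ 3 with hA
  -- Path lifting needs a positive rate, and the second bound can be negative near |z| = 1; the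
  -- larger of the two bounds is positive.
  set M : ℝ → ℝ := fun s => max (c * A s) (A s + (1 - c) * (s * (4 / 5 - 7 / 4 * s))) with hM
  have hAc : Continuous A := by
    refine Continuous.div (by fun_prop) (by fun_prop) fun s => ?_
    have := abs_nonneg s
    positivity
  have hMc : Continuous M := by fun_prop
  have hApos : ∀ s, 0 < A s := fun s => by
    have := abs_nonneg s
    simp only [hA]; positivity
  have hMpos : ∀ s, 0 < M s := fun s => lt_max_of_lt_left (mul_pos hc0 (hApos s))
  set T : ℝ → ℝ := fun s => ∫ t in (0 : ℝ)..s, M t with hTdef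
  have hT : ∀ s, HasDerivAt T (M s) s := fun s =>
    intervalIntegral.integral_hasDerivAt_right (hMc.intervalIntegrable _ _)
      (hMc.stronglyMeasurableAtFilter _ _) hMc.continuousAt
  have hT0 : T 0 = 0 := intervalIntegral.integral_same
  have hb : ∀ z ∈ ball (0 : ℂ) 1, M ‖z‖ ≤ ‖deriv (eulerOp f) z‖ := by
    intro z hz
    rcases eq_or_ne z 0 with rfl | hz0
    · rw [deriv_eulerOp_zero h.analytic, h.deriv_zero]
      simp [hM, hA, hc1]
    · have hzp := norm_pos_iff.2 hz0
      have h1 := h.first_bound_norm hz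
      have h2 := h.second_bound_norm hz
      have e : ‖eulerOp (eulerOp f) z‖ = ‖z‖ * ‖deriv (eulerOp f) z‖ := norm_mul _ _
      have eA : (‖z‖ ^ 3 / 3 + ‖z‖) / (1 + ‖z‖) ^ 3 = ‖z‖ * A ‖z‖ := by
        simp only [hA, abs_norm]; ring
      rw [e, eA, ← hc] at h1 h2
      refine max_le ?_ ?_
      · exact le_of_mul_le_mul_left (by linarith) hzp
      · exact le_of_mul_le_mul_left (by linarith) hzp
  have key := le_norm_of_injOn h.analytic₁ (eulerOp_zero f) h.injOn_eulerOp hT0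
    (fun s _ => hT s) (fun s _ => hMpos s) hb hz
  refine le_trans ?_ key
  have hmono : MonotoneOn (fun s : ℝ => T s - (2 / 3 * (s / (1 + s) ^ 2) + 1 / 3 * Real.log (1 + s)
      + (1 - c) * (2 / 5 * s ^ 2 - 7 / 12 * s ^ 3))) (Icc 0 ‖z‖) := by
    have hd : ∀ s ∈ Icc 0 ‖z‖, HasDerivAt (fun s : ℝ => T s - (2 / 3 * (s / (1 + s) ^ 2)
        + 1 / 3 * Real.log (1 + s) + (1 - c) * (2 / 5 * s ^ 2 - 7 / 12 * s ^ 3)))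
        (M s - ((s ^ 2 / 3 + 1) / (1 + s) ^ 3
          + (1 - c) * (2 * (2 / 5) * s - 3 * (7 / 12) * s ^ 2))) s := fun s hs =>
      (hT s).sub ((hasDerivAt_div_sq_add_log hs.1).add (hasDerivAt_cubic _ _ _ _))
    refine monotoneOn_of_deriv_nonneg (convex_Icc _ _)
      (fun s hs => (hd s hs).continuousAt.continuousWithinAt)
      (fun s hs => (hd s (interior_subset hs)).differentiableAt.differentiableWithinAt) ?_
    intro s hs
    have hs := interior_subset hs
    rw [(hd s hs).deriv, sub_nonneg]
    refine le_max_of_le_right (le_of_eq ?_)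
    simp only [hA, abs_of_nonneg hs.1]
    ring
  have := hmono (left_mem_Icc.2 (norm_nonneg z)) (right_mem_Icc.2 (norm_nonneg z)) (norm_nonneg z)
  simp [hT0] at this
  linarith

/-- The covering theorem for the class `𝒞₃`. -/
theorem ball_subset_image (h : CloseToConvexPair f g) :
    ball (0 : ℂ) ((12 + Real.pi ^ 2) / 36) ⊆ f '' ball 0 1 := by
  set e := 1 - (deriv g 0).re / ‖deriv g 0‖ with he
  have he0 : 0 ≤ e := sub_nonneg.2 h.cos_le_one
  have he1 : e ≤ 1 := by have := h.cos_pos; linarith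
  set T : ℝ → ℝ := fun s => 2 / 3 * (s / (1 + s)) - 1 / 3 * dilog (-s)
    + e * (1 / 5 * s ^ 2 - 7 / 36 * s ^ 3) with hTdef
  set T' : ℝ → ℝ := fun s => 2 / 3 * (1 / (1 + s) ^ 2) + 1 / 3 * dilogDeriv (-s)
    + e * (2 * (1 / 5) * s - 3 * (7 / 36) * s ^ 2) with hT'def
  have hT : ∀ s ∈ Ico (0 : ℝ) 1, HasDerivAt T (T' s) s := fun s hs =>
    (hasDerivAt_div_add_dilog hs.1 hs.2).add (hasDerivAt_cubic _ _ _ _)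
  have hT0 : T 0 = 0 := by simp [hTdef, dilog_zero]
  have hpos : ∀ s ∈ Ico (0 : ℝ) 1, 0 < T' s := by
    intro s hs
    have h1 := half_le_dilogDeriv_neg hs.1 hs.2
    have hs0 := hs.1
    have hs1 := hs.2
    -- The main terms give at least 2/3 · 1/4 + 1/3 · 1/2 = 1/3, while the correction is at least
    -- −1/5.
    have h2 : 1 / 4 ≤ 1 / (1 + s) ^ 2 := by
      apply one_div_le_one_div_of_le (by positivity); nlinarith
    have h3 : -(1 / 5) ≤ 2 * (1 / 5) * s - 3 * (7 / 36) * s ^ 2 := by nlinarith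
    have h4 : -(1 / 5) ≤ e * (2 * (1 / 5) * s - 3 * (7 / 36) * s ^ 2) := by nlinarith
    simp only [hT'def]
    linarith
  have hb : ∀ z ∈ ball (0 : ℂ) 1, T' ‖z‖ ≤ ‖deriv f z‖ := by
    intro z hz
    rcases eq_or_ne z 0 with rfl | hz0
    · rw [h.deriv_zero]
      simp only [hT'def, norm_zero, neg_zero, dilogDeriv_zero, norm_one]
      norm_num
    · have hzp := norm_pos_iff.2 hz0
      have h1 := h.le_norm_eulerOp hz
      have h2 := mul_dilogDeriv_neg (norm_nonneg z) (mem_ball_zero_iff.1 hz)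
      rw [← h2, eulerOp, norm_mul] at h1
      refine le_of_mul_le_mul_left (le_trans (le_of_eq ?_) h1) hzp
      simp only [hT'def]
      ring
  intro w hw
  rw [mem_ball_zero_iff] at hw
  -- T(1) = 1/3 + π²/36 + e(1/5 − 7/36), so the correction ends up nonnegative.
  have hT1 : (12 + Real.pi ^ 2) / 36 ≤ T 1 := by
    simp only [hTdef, dilog_neg_one]
    nlinarith
  have hTc : ContinuousWithinAt T (Iio 1) 1 := by
    have h1 : ContinuousOn T (Icc 0 1) := by
      have hd : ContinuousOn (fun s : ℝ => dilog (-s)) (Icc 0 1) :=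
        continuousOn_dilog.comp (by fun_prop) fun s hs => ⟨by linarith [hs.2], by linarith [hs.1]⟩
      have hq : ContinuousOn (fun s : ℝ => s / (1 + s)) (Icc 0 1) :=
        ContinuousOn.div (by fun_prop) (by fun_prop) fun s hs => by have := hs.1; positivity
      exact ((hq.const_smul (2 / 3 : ℝ)).sub (hd.const_smul (1 / 3 : ℝ))).add (by fun_prop)
    have h2 := h1 1 (right_mem_Icc.2 zero_le_one)
    refine (h2.mono_of_mem_nhdsWithin ?_)
    exact mem_of_superset (Ioo_mem_nhdsLT zero_lt_one) Ioo_subset_Icc_self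
  have hev : ∀ᶠ s in 𝓝[<] (1 : ℝ), ‖w‖ < T s ∧ s ∈ Ioo (0 : ℝ) 1 :=
    (hTc.eventually_const_lt (hw.trans_le hT1)).and (Ioo_mem_nhdsLT zero_lt_one)
  obtain ⟨ρ, hwρ, hρ⟩ := hev.exists
  have hTp : 0 < T ρ := (norm_nonneg w).trans_lt hwρ
  obtain ⟨k, hk1, hk2⟩ := exists_between ((div_lt_one hTp).2 hwρ)
  obtain ⟨z, hz, hfz, -⟩ := exists_preimage_of_norm_lt h.analytic h.map_zero hT0 hT hpos hb
    (lt_of_le_of_lt (by positivity) hk1) hk2 hρ.1.le hρ.2 ((div_lt_iff₀ hTp).1 hk1)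
  exact ⟨z, mem_ball_zero_iff.2 (hz.trans_lt hρ.2), hfz⟩

end CloseToConvexPair

end

/-! ### Boundary distance, majorant and radius equation -/

/-- The distance from the origin to the boundary of the image is at least the radius of any disc
contained in the image. -/
theorem le_boundaryDist {f : ℂ → ℂ} (hf : DifferentiableOn ℂ f (ball 0 1))
    (hi : InjOn f (ball 0 1)) (h0 : f 0 = 0) {δ : ℝ} (hδ : ball (0 : ℂ) δ ⊆ f '' ball 0 1) :
    δ ≤ boundaryDist f := by
  -- `infDist` to the empty set is 0, so the boundary has to be nonempty; by Liouville a univalent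
  -- image of the disc is not the plane.
  have hne : (frontier (f '' ball 0 1)).Nonempty := by
    rw [nonempty_frontier_iff]
    exact ⟨⟨f 0, mem_image_of_mem f (mem_ball_self one_pos)⟩, image_ball_ne_univ hf hi⟩
  have ho := (exists_holomorphic_inverse hf hi).1
  rw [boundaryDist, h0, le_infDist hne]
  intro y hy
  rw [ho.frontier_eq] at hy
  by_contra hlt
  refine hy.2 (hδ ?_)
  rw [mem_ball, dist_comm]
  exact not_le.1 hlt

theorem NormalizedC3.le_boundaryDist {f : ℂ → ℂ} (hf : NormalizedC3 f) :
    (12 + Real.pi ^ 2) / 36 ≤ boundaryDist f := by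
  obtain ⟨g, h⟩ := hf.exists_pair
  exact _root_.le_boundaryDist h.analytic h.injOn h.map_zero h.ball_subset_image

theorem NormalizedC3.norm_taylorCoeff_le {f : ℂ → ℂ} (hf : NormalizedC3 f) {n : ℕ} (hn : n ≠ 0) :
    ‖taylorCoeff f n‖ ≤ 2 / 3 + 1 / (3 * (n : ℝ) ^ 2) := by
  obtain ⟨g, h⟩ := hf.exists_pair
  exact h.norm_taylorCoeff_le hn

/-- The sharp coefficient bound in the class `𝒞₃`. -/
noncomputable def coeffBound (n : ℕ) : ℝ := 2 / 3 + 1 / (3 * (n : ℝ) ^ 2)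

/-- The tail `∑_{n ≥ N} (2/3 + 1/(3n²)) rⁿ` of the extremal power series. -/
noncomputable def tailMajorant (N : ℕ) (r : ℝ) : ℝ := ∑' n : ℕ, coeffBound (N + n) * r ^ (N + n)

theorem coeffBound_pos (n : ℕ) : 0 < coeffBound n := by
  unfold coeffBound; positivity

theorem coeffBound_le_one (n : ℕ) : coeffBound n ≤ 1 := by
  unfold coeffBound
  -- At n = 0 the convention 1/0 = 0 leaves the value 2/3.
  rcases Nat.eq_zero_or_pos n with rfl | hn
  · norm_num
  · have h1 : (1 : ℝ) ≤ n := by exact_mod_cast hn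
    have h2 : 1 / (3 * (n : ℝ) ^ 2) ≤ 1 / 3 := by
      apply one_div_le_one_div_of_le (by norm_num); nlinarith
    linarith

theorem summable_pow_add (N : ℕ) {r : ℝ} (hr0 : 0 ≤ r) (hr : r < 1) :
    Summable fun n : ℕ => r ^ (N + n) := by
  simp only [pow_add]
  exact (summable_geometric_of_lt_one hr0 hr).mul_left _

theorem summable_tailMajorant (N : ℕ) {r : ℝ} (hr0 : 0 ≤ r) (hr : r < 1) :
    Summable fun n : ℕ => coeffBound (N + n) * r ^ (N + n) :=
  (summable_pow_add N hr0 hr).of_nonneg_of_le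
    (fun _ => mul_nonneg (coeffBound_pos _).le (pow_nonneg hr0 _))
    fun _ => mul_le_of_le_one_left (pow_nonneg hr0 _) (coeffBound_le_one _)

theorem tailMajorant_le (N : ℕ) {r s : ℝ} (hr0 : 0 ≤ r) (hrs : r ≤ s) (hs : s < 1) :
    tailMajorant N r ≤ tailMajorant N s := by
  refine (summable_tailMajorant N hr0 (hrs.trans_lt hs)).tsum_le_tsum (fun n => ?_)
    (summable_tailMajorant N (hr0.trans hrs) hs)
  have := (coeffBound_pos (N + n)).le
  gcongr

theorem tailMajorant_one_lt {r s : ℝ} (hr0 : 0 ≤ r) (hrs : r < s) (hs : s < 1) :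
    tailMajorant 1 r < tailMajorant 1 s := by
  refine Summable.tsum_lt_tsum (i := 0) (fun n => ?_) ?_
    (summable_tailMajorant 1 hr0 (hrs.trans hs)) (summable_tailMajorant 1 (hr0.trans hrs.le) hs)
  · have := (coeffBound_pos (1 + n)).le
    gcongr
  · have := coeffBound_pos 1
    simp only [add_zero, pow_one]
    gcongr

theorem continuousOn_tailMajorant (N : ℕ) {ρ : ℝ} (hρ0 : 0 ≤ ρ) (hρ : ρ < 1) :
    ContinuousOn (tailMajorant N) (Icc 0 ρ) := by
  refine continuousOn_tsum (fun n => by fun_prop) (summable_pow_add N hρ0 hρ) fun n x hx => ?_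
  have hx0 := hx.1
  rw [Real.norm_of_nonneg (mul_nonneg (coeffBound_pos _).le (pow_nonneg hx0 _))]
  refine (mul_le_of_le_one_left (pow_nonneg hx0 _) (coeffBound_le_one _)).trans ?_
  exact pow_le_pow_left₀ hx0 hx.2 _

theorem tailMajorant_zero {N : ℕ} (hN : 1 ≤ N) : tailMajorant N 0 = 0 := by
  refine (tsum_congr fun n => ?_).trans tsum_zero
  rw [zero_pow (by omega), mul_zero]

theorem tailMajorant_eq {N : ℕ} {r : ℝ} (hr0 : 0 ≤ r) (hr : r < 1) :
    tailMajorant N r = 2 / 3 * (r ^ N / (1 - r))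
      + ∑' n : ℕ, r ^ (N + n) / (3 * ((N + n : ℕ) : ℝ) ^ 2) := by
  have h1 : HasSum (fun n : ℕ => 2 / 3 * r ^ (N + n)) (2 / 3 * (r ^ N / (1 - r))) := by
    simp only [pow_add, div_eq_mul_inv (r ^ N)]
    exact ((hasSum_geometric_of_lt_one hr0 hr).mul_left _).mul_left _
  have h2 : Summable fun n : ℕ => r ^ (N + n) / (3 * ((N + n : ℕ) : ℝ) ^ 2) := by
    refine ((summable_tailMajorant N hr0 hr).sub h1.summable).congr fun n => ?_
    rw [coeffBound]; ring
  rw [← h1.tsum_eq, ← h1.summable.tsum_add h2, tailMajorant]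
  refine tsum_congr fun n => ?_
  rw [coeffBound]; ring

theorem tsum_dilog {r : ℝ} (hr0 : 0 ≤ r) (hr : r < 1) :
    ∑' n : ℕ, r ^ (1 + n) / (3 * ((1 + n : ℕ) : ℝ) ^ 2) = 1 / 3 * dilog r := by
  rw [dilog, (summable_dilog (by rw [abs_of_nonneg hr0]; exact hr.le)).tsum_eq_zero_add]
  simp only [Nat.cast_zero, ne_eq, OfNat.ofNat_ne_zero, not_false_eq_true, zero_pow, div_zero,
    zero_add]
  rw [← tsum_mul_left]
  refine tsum_congr fun n => ?_
  rw [add_comm 1 n]; ring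

theorem continuousOn_dilogDeriv {ρ : ℝ} (hρ0 : 0 ≤ ρ) (hρ : ρ < 1) :
    ContinuousOn dilogDeriv (Icc 0 ρ) := by
  refine continuousOn_tsum (fun n => by fun_prop) (summable_geometric_of_lt_one hρ0 hρ)
    fun n x hx => ?_
  have hx0 := hx.1
  rw [Real.norm_of_nonneg (by positivity)]
  refine (div_le_self (by positivity) ?_).trans (pow_le_pow_left₀ hx0 hx.2 n)
  have : (0 : ℝ) ≤ n := n.cast_nonneg
  linarith

theorem integral_log_div {r : ℝ} (hr0 : 0 ≤ r) (hr : r < 1) :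
    ∫ t in (0 : ℝ)..r, Real.log (1 - t) / t = -dilog r := by
  have h1 : ∫ t in (0 : ℝ)..r, Real.log (1 - t) / t = ∫ t in (0 : ℝ)..r, -dilogDeriv t := by
    refine intervalIntegral.integral_congr_ae (Eventually.of_forall fun t ht => ?_)
    rw [uIoc_of_le hr0] at ht
    have h2 := mul_dilogDeriv (x := t) (by rw [abs_of_pos ht.1]; exact ht.2.trans_lt hr)
    have := ht.1.ne'
    rw [div_eq_iff this]
    linarith
  rw [h1, intervalIntegral.integral_neg]
  rw [intervalIntegral.integral_eq_sub_of_hasDerivAt (f := dilog), dilog_zero, sub_zero]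
  · intro x hx
    rw [uIcc_of_le hr0] at hx
    exact hasDerivAt_dilog (by rw [abs_of_nonneg hx.1]; exact hx.2.trans_lt hr)
  · apply ContinuousOn.intervalIntegrable
    rw [uIcc_of_le hr0]
    exact continuousOn_dilogDeriv hr0 hr

/-- In this form the equation equates the majorant of the Bohr–Rogosinski sum with the covering
radius, and monotonicity in r is visible. -/
theorem radiusFun_eq (N : ℕ) {r : ℝ} (hr0 : 0 ≤ r) (hr : r < 1) :
    radiusFun N r = tailMajorant 1 r + tailMajorant N r - (12 + Real.pi ^ 2) / 36 := by
  rw [radiusFun, integral_log_div hr0 hr, tailMajorant_eq hr0 hr, tailMajorant_eq hr0 hr,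
    tsum_dilog hr0 hr, pow_one]
  have h1 : 1 - r ≠ 0 := by linarith
  have e : (12 + Real.pi ^ 2 - 36 * r - Real.pi ^ 2 * r - 24 * r ^ N) / (36 * (1 - r))
      = (12 + Real.pi ^ 2) / 36 - 2 / 3 * (r / (1 - r)) - 2 / 3 * (r ^ N / (1 - r)) := by
    field_simp
    ring
  rw [e]
  ring

theorem majorant_lt {N : ℕ} {r s : ℝ} (hr0 : 0 ≤ r) (hrs : r < s) (hs : s < 1) :
    tailMajorant 1 r + tailMajorant N r < tailMajorant 1 s + tailMajorant N s :=
  add_lt_add_of_lt_of_le (tailMajorant_one_lt hr0 hrs hs) (tailMajorant_le N hr0 hrs.le hs)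

theorem exists_radius {N : ℕ} (hN : 1 ≤ N) : ∃ R ∈ Ioo (0 : ℝ) 1,
    tailMajorant 1 R + tailMajorant N R = (12 + Real.pi ^ 2) / 36 := by
  have hc : ContinuousOn (fun r => tailMajorant 1 r + tailMajorant N r) (Icc 0 (1 / 2)) :=
    (continuousOn_tailMajorant 1 (by norm_num) (by norm_num)).add
      (continuousOn_tailMajorant N (by norm_num) (by norm_num))
  have hpi : Real.pi ^ 2 < 9.9225 := by
    have := Real.pi_lt_d2
    have := Real.pi_pos
    nlinarith
  have h0 : tailMajorant 1 0 + tailMajorant N 0 = 0 := by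
    rw [tailMajorant_zero le_rfl, tailMajorant_zero hN, add_zero]
  -- At r = 1/2 the term 2/3 · r/(1 − r) = 2/3 alone exceeds (12 + π²)/36 < 0.61.
  have h1 : (12 + Real.pi ^ 2) / 36 < tailMajorant 1 (1 / 2) + tailMajorant N (1 / 2) := by
    have h2 : 0 ≤ tailMajorant N (1 / 2) :=
      tsum_nonneg fun n => mul_nonneg (coeffBound_pos _).le (by positivity)
    have h3 : 0 ≤ ∑' n : ℕ, (1 / 2 : ℝ) ^ (1 + n) / (3 * ((1 + n : ℕ) : ℝ) ^ 2) :=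
      tsum_nonneg fun n => by positivity
    rw [tailMajorant_eq (N := 1) (by norm_num) (by norm_num)]
    norm_num at h3 ⊢
    linarith
  have hpos : (0 : ℝ) < (12 + Real.pi ^ 2) / 36 := by positivity
  obtain ⟨R, hR, hRe⟩ := intermediate_value_Icc (by norm_num : (0 : ℝ) ≤ 1 / 2) hc
    ⟨by simp only [h0]; exact hpos.le, h1.le⟩
  refine ⟨R, ⟨hR.1.lt_of_ne ?_, hR.2.trans_lt (by norm_num)⟩, hRe⟩
  rintro rfl
  simp only [h0] at hRe
  exact hpos.ne hRe

theorem NormalizedC3.norm_term_le {f : ℂ → ℂ} (hf : NormalizedC3 f) {n : ℕ} (hn : n ≠ 0) (z : ℂ) :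
    ‖taylorCoeff f n * z ^ n‖ ≤ coeffBound n * ‖z‖ ^ n := by
  rw [norm_mul, norm_pow]
  exact mul_le_mul_of_nonneg_right (hf.norm_taylorCoeff_le hn) (by positivity)

theorem NormalizedC3.summable_tail {f : ℂ → ℂ} (hf : NormalizedC3 f) {N : ℕ} (hN : 1 ≤ N) {z : ℂ}
    (hz : ‖z‖ < 1) : Summable fun n : ℕ => ‖taylorCoeff f (N + n) * z ^ (N + n)‖ :=
  (summable_tailMajorant N (norm_nonneg z) hz).of_nonneg_of_le (fun _ => norm_nonneg _)
    fun _ => hf.norm_term_le (by omega) z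

theorem NormalizedC3.tsum_tail_le {f : ℂ → ℂ} (hf : NormalizedC3 f) {N : ℕ} (hN : 1 ≤ N) {z : ℂ}
    (hz : ‖z‖ < 1) :
    ∑' n : ℕ, ‖taylorCoeff f (N + n) * z ^ (N + n)‖ ≤ tailMajorant N ‖z‖ :=
  (hf.summable_tail hN hz).tsum_le_tsum (fun _ => hf.norm_term_le (by omega) z)
    (summable_tailMajorant N (norm_nonneg z) hz)

theorem NormalizedC3.norm_le {f : ℂ → ℂ} (hf : NormalizedC3 f) {z : ℂ} (hz : ‖z‖ < 1) :
    ‖f z‖ ≤ tailMajorant 1 ‖z‖ := by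
  have h1 := hasSum_taylorCoeff hf.mem.analytic (mem_ball_zero_iff.2 hz)
  have h2 : f z = ∑' n : ℕ, taylorCoeff f (1 + n) * z ^ (1 + n) := by
    rw [← h1.tsum_eq, h1.summable.tsum_eq_zero_add, taylorCoeff_zero, hf.map_zero]
    simp [add_comm]
  rw [h2]
  exact (norm_tsum_le_tsum_norm (hf.summable_tail le_rfl hz)).trans (hf.tsum_tail_le le_rfl hz)

theorem NormalizedC3.bohrRogosinskiSum_le {f : ℂ → ℂ} (hf : NormalizedC3 f) {N : ℕ} (hN : 1 ≤ N)
    {z : ℂ} (hz : ‖z‖ < 1) :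
    bohrRogosinskiSum N f z ≤ tailMajorant 1 ‖z‖ + tailMajorant N ‖z‖ :=
  add_le_add (hf.norm_le hz) (hf.tsum_tail_le hN hz)

/-! ### The half-plane map `z / (1 - z)` -/

theorem one_sub_ne_zero {z : ℂ} (hz : z ∈ ball (0 : ℂ) 1) : 1 - z ≠ 0 := by
  intro h
  rw [mem_ball_zero_iff, ← sub_eq_zero.1 h, norm_one] at hz
  exact lt_irrefl _ hz

theorem hasDerivAt_one_sub_pow_inv (n : ℕ) {z : ℂ} (hz : z ∈ ball (0 : ℂ) 1) :
    HasDerivAt (fun z : ℂ => ((1 - z) ^ (n + 1))⁻¹) ((n + 1) / (1 - z) ^ (n + 2)) z := by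
  have h0 := one_sub_ne_zero hz
  have h1 : HasDerivAt (fun z : ℂ => 1 - z) (-1) z := (hasDerivAt_id z).const_sub 1
  refine ((h1.fun_pow (n + 1)).fun_inv (pow_ne_zero _ h0)).congr_deriv ?_
  push_cast
  field_simp
  ring

theorem hasDerivAt_halfPlaneMap {z : ℂ} (hz : z ∈ ball (0 : ℂ) 1) :
    HasDerivAt (fun z : ℂ => z / (1 - z)) (1 / (1 - z) ^ 2) z := by
  have h0 := one_sub_ne_zero hz
  have h1 : HasDerivAt (fun z : ℂ => 1 - z) (-1) z := (hasDerivAt_id z).const_sub 1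
  refine ((hasDerivAt_id z).div h1 h0).congr_deriv ?_
  simp only [id]
  field_simp
  ring

theorem image_halfPlaneMap :
    (fun z : ℂ => z / (1 - z)) '' ball 0 1 = {w : ℂ | -(1 / 2) < w.re} := by
  ext w
  simp only [mem_image, mem_ofPred_eq]
  have key : ∀ w : ℂ, ‖w‖ < ‖1 + w‖ ↔ -(1 / 2) < w.re := by
    intro w
    rw [← sq_lt_sq₀ (norm_nonneg _) (norm_nonneg _), Complex.sq_norm, Complex.sq_norm,
      Complex.normSq_apply, Complex.normSq_apply]
    simp only [Complex.add_re, Complex.add_im, Complex.one_re, Complex.one_im]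
    constructor <;> intro h <;> nlinarith
  constructor
  · rintro ⟨z, hz, rfl⟩
    have h0 := one_sub_ne_zero hz
    rw [← key]
    have e : 1 + z / (1 - z) = 1 / (1 - z) := by field_simp; ring
    rw [e, norm_div, norm_div, norm_one]
    have := norm_pos_iff.2 h0
    have := mem_ball_zero_iff.1 hz
    gcongr
  · intro hw
    have h1 := (key w).2 hw
    have h2 : 1 + w ≠ 0 := norm_pos_iff.1 ((norm_nonneg w).trans_lt h1)
    refine ⟨w / (1 + w), ?_, ?_⟩
    · rw [mem_ball_zero_iff, norm_div, div_lt_one (norm_pos_iff.2 h2)]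
      exact h1
    · have e : 1 - w / (1 + w) = 1 / (1 + w) := by field_simp; ring
      rw [e]
      field_simp

theorem isConvexMap_halfPlaneMap : IsConvexMap fun z : ℂ => z / (1 - z) where
  analytic _ hz := (hasDerivAt_halfPlaneMap hz).differentiableAt.differentiableWithinAt
  univalent := by
    intro z hz w hw h
    simp only at h
    rw [div_eq_div_iff (one_sub_ne_zero hz) (one_sub_ne_zero hw)] at h
    linear_combination h
  convex_image := by
    rw [image_halfPlaneMap]
    exact convex_halfSpace_re_gt _
  map_zero := by simp
  re_deriv_pos := by
    rw [(hasDerivAt_halfPlaneMap (mem_ball_self one_pos)).deriv]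
    simp

theorem deriv_eulerOp_halfPlaneMap {z : ℂ} (hz : z ∈ ball (0 : ℂ) 1) :
    deriv (eulerOp fun z : ℂ => z / (1 - z)) z = (1 + z) / (1 - z) ^ 3 := by
  have h0 := one_sub_ne_zero hz
  have h1 : eulerOp (fun z : ℂ => z / (1 - z)) =ᶠ[𝓝 z] fun z => z * ((1 - z) ^ (1 + 1))⁻¹ := by
    filter_upwards [isOpen_ball.mem_nhds hz] with w hw
    rw [eulerOp, (hasDerivAt_halfPlaneMap hw).deriv, one_div]
  rw [h1.deriv_eq]
  refine ((hasDerivAt_id z).mul (hasDerivAt_one_sub_pow_inv 1 hz)).deriv.trans ?_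
  simp only [id]
  push_cast
  field_simp
  ring

/-! ### The extremal function -/

/-- The function `∑ (2/3 + 1/(3n²)) zⁿ`, that is, `(2/3) z/(1-z) + (1/3) Li₂(z)`. -/
noncomputable def extremalFun (z : ℂ) : ℂ :=
  ∑' n : ℕ, ((if n = 0 then 0 else coeffBound n : ℝ) : ℂ) * z ^ n

theorem hasSum_extremalFun {z : ℂ} (hz : z ∈ ball (0 : ℂ) 1) :
    HasSum (fun n : ℕ => ((if n = 0 then 0 else coeffBound n : ℝ) : ℂ) * z ^ n)
      (extremalFun z) := by
  refine (Summable.of_norm_bounded (summable_geometric_of_lt_one (norm_nonneg z)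
    (mem_ball_zero_iff.1 hz)) fun n => ?_).hasSum
  rw [norm_mul, norm_pow, Complex.norm_real]
  refine mul_le_of_le_one_left (by positivity) ?_
  split_ifs
  · simp
  · rw [Real.norm_of_nonneg (coeffBound_pos n).le]
    exact coeffBound_le_one n

theorem differentiableOn_extremalFun : DifferentiableOn ℂ extremalFun (ball 0 1) :=
  differentiableOn_of_hasSum fun _ => hasSum_extremalFun

theorem taylorCoeff_extremalFun (n : ℕ) :
    taylorCoeff extremalFun n = ((if n = 0 then 0 else coeffBound n : ℝ) : ℂ) :=
  taylorCoeff_eq_of_hasSum (fun _ => hasSum_extremalFun) n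

theorem eulerOp_eulerOp_extremalFun {z : ℂ} (hz : z ∈ ball (0 : ℂ) 1) :
    eulerOp (eulerOp extremalFun) z
      = 4 / 3 * ((1 - z) ^ (2 + 1))⁻¹ - 2 * ((1 - z) ^ (1 + 1))⁻¹ + ((1 - z) ^ (0 + 1))⁻¹
        - 1 / 3 := by
  have hz1 := mem_ball_zero_iff.1 hz
  have h1 := hasSum_taylorCoeff (differentiableOn_eulerOp
    (differentiableOn_eulerOp differentiableOn_extremalFun)) hz
  -- For n ≥ 1, n²(2/3 + 1/(3n²)) = (4/3)·C(n+2, 2) − 2(n + 1) + 1. At n = 0 the right side is 1/3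
  -- but the coefficient is 0, hence the final −1/3.
  have h2 := (((hasSum_choose_mul_geometric_of_norm_lt_one 2 hz1).mul_left (4 / 3)).sub
    ((hasSum_choose_mul_geometric_of_norm_lt_one 1 hz1).mul_left 2)).add
    (hasSum_choose_mul_geometric_of_norm_lt_one 0 hz1)
  have h3 := h2.sub (hasSum_single (f := fun n : ℕ => if n = 0 then (1 / 3 : ℂ) else 0) 0
    fun n hn => if_neg hn)
  simp only [one_div] at h3 ⊢
  refine HasSum.unique (h1.congr_fun fun n => ?_) h3
  rw [taylorCoeff_eulerOp (differentiableOn_eulerOp differentiableOn_extremalFun),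
    taylorCoeff_eulerOp differentiableOn_extremalFun, taylorCoeff_extremalFun]
  rcases eq_or_ne n 0 with rfl | hn
  · norm_num
  · have hn' : (n : ℂ) ≠ 0 := by exact_mod_cast hn
    rw [if_neg hn, if_neg hn, coeffBound, Nat.cast_choose_two]
    simp only [Nat.choose_one_right, Nat.choose_zero_right]
    push_cast
    field_simp
    ring

/-- Divided by (1 + z)/(1 − z)³, which belongs to g = z/(1 − z), this gives p = (1 + z)/(1 − z):
Carathéodory's and Loewner's bounds are attained simultaneously. -/
theorem deriv_eulerOp_eulerOp_extremalFun {z : ℂ} (hz : z ∈ ball (0 : ℂ) 1) :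
    deriv (eulerOp (eulerOp extremalFun)) z = (1 + z) ^ 2 / (1 - z) ^ 4 := by
  have h0 := one_sub_ne_zero hz
  have h1 : eulerOp (eulerOp extremalFun) =ᶠ[𝓝 z] fun z =>
      4 / 3 * ((1 - z) ^ (2 + 1))⁻¹ - 2 * ((1 - z) ^ (1 + 1))⁻¹ + ((1 - z) ^ (0 + 1))⁻¹
        - 1 / 3 := by
    filter_upwards [isOpen_ball.mem_nhds hz] with w hw
    exact eulerOp_eulerOp_extremalFun hw
  rw [h1.deriv_eq]
  refine (((((hasDerivAt_one_sub_pow_inv 2 hz).const_mul (4 / 3)).sub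
    ((hasDerivAt_one_sub_pow_inv 1 hz).const_mul 2)).add
    (hasDerivAt_one_sub_pow_inv 0 hz)).sub_const (1 / 3)).deriv.trans ?_
  push_cast
  field_simp
  ring

theorem normalizedC3_extremalFun : NormalizedC3 extremalFun where
  mem := by
    refine ⟨differentiableOn_extremalFun, _, isConvexMap_halfPlaneMap, fun z hz => ?_⟩
    have h0 := one_sub_ne_zero hz
    rw [deriv_eulerOp_eulerOp_extremalFun hz, deriv_eulerOp_halfPlaneMap hz]
    have hz1 : 1 + z ≠ 0 := by
      have := one_sub_ne_zero (z := -z) (by simpa using hz)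
      rwa [sub_neg_eq_add] at this
    have e : (1 + z) ^ 2 / (1 - z) ^ 4 / ((1 + z) / (1 - z) ^ 3) = (1 + z) / (1 - z) := by
      field_simp
    rw [e, Complex.div_re, ← add_div]
    refine div_pos ?_ (Complex.normSq_pos.2 h0)
    have h1 := mem_ball_zero_iff.1 hz
    have h2 : z.re * z.re + z.im * z.im < 1 := by
      rw [← Complex.normSq_apply, Complex.normSq_eq_norm_sq]
      exact pow_lt_one₀ (norm_nonneg z) h1 two_ne_zero
    simp only [Complex.add_re, Complex.sub_re, Complex.add_im, Complex.sub_im, Complex.one_re,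
      Complex.one_im]
    nlinarith
  map_zero := by rw [← taylorCoeff_zero extremalFun, taylorCoeff_extremalFun]; simp
  deriv_zero := by
    rw [← taylorCoeff_one extremalFun, taylorCoeff_extremalFun, coeffBound]; norm_num

theorem extremalFun_ofReal {x : ℝ} (hx : |x| < 1) :
    extremalFun x = ((2 / 3 * (x / (1 - x)) + 1 / 3 * dilog x : ℝ) : ℂ) := by
  have h1 := hasSum_extremalFun (z := x) (by simpa using hx)
  have h2 : HasSum (fun n : ℕ => 2 / 3 * (x ^ n - if n = 0 then 1 else 0)
      + 1 / 3 * (x ^ n / (n : ℝ) ^ 2)) (2 / 3 * ((1 - x)⁻¹ - 1) + 1 / 3 * dilog x) := by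
    have h3 := hasSum_single (f := fun n : ℕ => if n = 0 then (1 : ℝ) else 0) 0
      fun n hn => if_neg hn
    simp only [if_true] at h3
    exact (((hasSum_geometric_of_abs_lt_one hx).sub h3).mul_left _).add
      ((summable_dilog hx.le).hasSum.mul_left _)
  have hne : 1 - x ≠ 0 := by have := (abs_lt.1 hx).2; linarith
  have e : (1 - x)⁻¹ - 1 = x / (1 - x) := by field_simp; ring
  rw [e] at h2
  refine h1.unique ((Complex.hasSum_ofReal.2 h2).congr_fun fun n => ?_)
  rcases eq_or_ne n 0 with rfl | hn
  · simp
  · rw [if_neg hn, if_neg hn, coeffBound]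
    push_cast
    ring

/-- The covering bound is attained along the negative radius, by continuity of the dilogarithm up to
−1. -/
theorem tendsto_extremalFun_neg :
    Tendsto (fun r : ℝ => extremalFun ((-r : ℝ) : ℂ)) (𝓝[<] 1)
      (𝓝 ((-((12 + Real.pi ^ 2) / 36) : ℝ) : ℂ)) := by
  set Φ : ℝ → ℝ := fun r => 2 / 3 * (-r / (1 - -r)) + 1 / 3 * dilog (-r) with hΦ
  have h1 : ContinuousOn Φ (Icc 0 1) := by
    have hd : ContinuousOn (fun s : ℝ => dilog (-s)) (Icc 0 1) :=
      continuousOn_dilog.comp (by fun_prop) fun s hs => ⟨by linarith [hs.2], by linarith [hs.1]⟩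
    have hq : ContinuousOn (fun s : ℝ => -s / (1 - -s)) (Icc 0 1) :=
      ContinuousOn.div (by fun_prop) (by fun_prop) fun s hs => by have := hs.1; linarith
    exact (hq.const_smul (2 / 3 : ℝ)).add (hd.const_smul (1 / 3 : ℝ))
  have h2 : Φ 1 = -((12 + Real.pi ^ 2) / 36) := by
    simp only [hΦ, dilog_neg_one]; ring
  have h3 : Tendsto Φ (𝓝[<] 1) (𝓝 (-((12 + Real.pi ^ 2) / 36))) := by
    rw [← h2]
    exact (h1 1 (right_mem_Icc.2 zero_le_one)).mono_of_mem_nhdsWithin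
      (mem_of_superset (Ioo_mem_nhdsLT zero_lt_one) Ioo_subset_Icc_self)
  refine ((Complex.continuous_ofReal.tendsto _).comp h3).congr' ?_
  filter_upwards [Ioo_mem_nhdsLT (zero_lt_one (α := ℝ))] with r hr
  rw [extremalFun_ofReal (by rw [abs_neg, abs_of_pos hr.1]; exact hr.2)]
  rfl

theorem boundaryDist_extremalFun : boundaryDist extremalFun = (12 + Real.pi ^ 2) / 36 := by
  refine le_antisymm ?_ normalizedC3_extremalFun.le_boundaryDist
  obtain ⟨g, hp⟩ := normalizedC3_extremalFun.exists_pair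
  obtain ⟨ho, -, ψ, hψ, hl⟩ := exists_holomorphic_inverse hp.analytic hp.injOn
  set w : ℂ := ((-((12 + Real.pi ^ 2) / 36) : ℝ) : ℂ) with hw
  have hmem : ∀ᶠ r : ℝ in 𝓝[<] (1 : ℝ), ((-r : ℝ) : ℂ) ∈ ball (0 : ℂ) 1 := by
    filter_upwards [Ioo_mem_nhdsLT (zero_lt_one (α := ℝ))] with r hr
    rw [mem_ball_zero_iff, Complex.norm_real, norm_neg, Real.norm_of_nonneg hr.1.le]
    exact hr.2
  have hcl : w ∈ closure (extremalFun '' ball 0 1) :=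
    mem_closure_of_tendsto tendsto_extremalFun_neg (hmem.mono fun r hr => mem_image_of_mem _ hr)
  -- If w were a value, continuity of the inverse at w would force its preimage to be lim(−r) = −1,
  -- which is outside the disc.
  have hnot : w ∉ extremalFun '' ball 0 1 := by
    intro hin
    have h1 : Tendsto (fun r : ℝ => ψ (extremalFun ((-r : ℝ) : ℂ))) (𝓝[<] 1) (𝓝 (ψ w)) :=
      (hψ.continuousOn.continuousAt (ho.mem_nhds hin)).tendsto.comp tendsto_extremalFun_neg
    have h2 : Tendsto (fun r : ℝ => ((-r : ℝ) : ℂ)) (𝓝[<] 1) (𝓝 ((-1 : ℝ) : ℂ)) :=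
      ((Complex.continuous_ofReal.comp continuous_neg).tendsto 1).mono_left nhdsWithin_le_nhds
    have h3 := tendsto_nhds_unique (h1.congr' (hmem.mono fun r hr => hl _ hr)) h2
    obtain ⟨z, hz, hzw⟩ := hin
    rw [← hzw, hl z hz] at h3
    rw [h3, mem_ball_zero_iff] at hz
    simp at hz
  have hfr : w ∈ frontier (extremalFun '' ball 0 1) := by
    rw [ho.frontier_eq]; exact ⟨hcl, hnot⟩
  refine (infDist_le_dist_of_mem hfr).trans_eq ?_
  rw [normalizedC3_extremalFun.map_zero, dist_zero_left, hw, Complex.norm_real, norm_neg,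
    Real.norm_of_nonneg (by positivity)]

/-- The coefficients of positive index are positive, so at z = r the triangle inequality loses
nothing. -/
theorem bohrRogosinskiSum_extremalFun {N : ℕ} (hN : 1 ≤ N) {r : ℝ} (hr0 : 0 ≤ r) (hr : r < 1) :
    bohrRogosinskiSum N extremalFun (r : ℂ) = tailMajorant 1 r + tailMajorant N r := by
  have habs : |r| < 1 := by rwa [abs_of_nonneg hr0]
  rw [bohrRogosinskiSum]
  congr 1
  · rw [extremalFun_ofReal habs, tailMajorant_eq hr0 hr, tsum_dilog hr0 hr, pow_one,
      Complex.norm_real, Real.norm_of_nonneg]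
    have h1 : 0 ≤ dilog r := tsum_nonneg fun n => by positivity
    have h2 : 0 < 1 - r := by linarith
    positivity
  · refine tsum_congr fun n => ?_
    rw [taylorCoeff_extremalFun, if_neg (by omega), ← Complex.ofReal_pow, ← Complex.ofReal_mul,
      Complex.norm_real,
      Real.norm_of_nonneg (mul_nonneg (coeffBound_pos _).le (pow_nonneg hr0 _))]

/-! ### The radius and its sharpness -/

theorem mainTheorem11 (N : ℕ) (hN : 1 ≤ N) :
    ∃ R : ℝ, R ∈ Ioo (0 : ℝ) 1 ∧ radiusFun N R = 0 ∧
      (∀ r ∈ Ioo (0 : ℝ) 1, radiusFun N r = 0 → r = R) ∧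
      -- the inequality in the disc of radius `R`, for the whole class
      (∀ f : ℂ → ℂ, NormalizedC3 f → ∀ z : ℂ, ‖z‖ ≤ R →
        Summable (fun n : ℕ => ‖taylorCoeff f (N + n) * z ^ (N + n)‖) ∧
        bohrRogosinskiSum N f z ≤ boundaryDist f) ∧
      -- sharpness: one function gives equality at `R` and violates the inequality beyond `R`
      (∃ f : ℂ → ℂ, NormalizedC3 f ∧
        bohrRogosinskiSum N f (R : ℂ) = boundaryDist f ∧
        ∀ r ∈ Ioo R 1, boundaryDist f < bohrRogosinskiSum N f (r : ℂ)) := by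
  obtain ⟨R, hR, hRe⟩ := exists_radius hN
  refine ⟨R, hR, ?_, ?_, ?_, extremalFun, normalizedC3_extremalFun, ?_, ?_⟩
  · rw [radiusFun_eq N hR.1.le hR.2, hRe, sub_self]
  · intro r hr h
    rw [radiusFun_eq N hr.1.le hr.2, ← hRe] at h
    rcases lt_trichotomy r R with hlt | heq | hlt
    · have := majorant_lt (N := N) hr.1.le hlt hR.2
      linarith
    · exact heq
    · have := majorant_lt (N := N) hR.1.le hlt hr.2
      linarith
  · intro f hf z hz
    have hz1 := hz.trans_lt hR.2
    refine ⟨hf.summable_tail hN hz1, (hf.bohrRogosinskiSum_le hN hz1).trans ?_⟩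
    refine le_trans ?_ hf.le_boundaryDist
    rw [← hRe]
    exact add_le_add (tailMajorant_le 1 (norm_nonneg z) hz hR.2)
      (tailMajorant_le N (norm_nonneg z) hz hR.2)
  · rw [bohrRogosinskiSum_extremalFun hN hR.1.le hR.2, boundaryDist_extremalFun, hRe]
  · intro r hr
    rw [bohrRogosinskiSum_extremalFun hN (hR.1.trans hr.1).le hr.2, boundaryDist_extremalFun, ← hRe]
    exact majorant_lt hR.1.le hr.1 hr.2
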